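/- Let $G$ be a topological group. We write $G\in\mathbf{OB}$ if for every continuous isometric action of $G$ on a metric space all orbits are bounded; $G\in\mathbf{FH}$ if every continuous affine isometric action of $G$ on a real Hilbert space has a fixed point; and $G\in\mathbf{F}\mathbb{R}$ if every continuous isometric action of $G$ on a (nonempty, not necessarily complete) real tree has a fixed point. A topological group is non-$\mathbf{OB}$ (non-$\mathbf{FH}$, non-$\mathbf{F}\mathbb{R}$) if it is not in $\mathbf{OB}$ (resp. $\mathbf{FH}$, $\mathbf{F}\mathbb{R}$). A real tree is a uniquely geodesic metric space in which $[y,x]\cap[x,z]=\{x\}$ implies $[y,x]\cup[x,z]=[y,z]$ for all points $x,y,z$. A class $\mathcal K$ of discrete groups is called bountiful if for any infinite groups $G\le H$ with $H\in\mathcal K$ there is $K\in\mathcal K$ such that $G\le K\le H$ and $|G|=|K|$. A metric group that is a continuous structure is a group with a complete bi-invariant metric $d\le D$, where $D\in(0,\infty]$ is any fixed bound ($D=\infty$ means that no bound is imposed). A class $\mathcal K$ of such groups is called bountiful if for any infinite $H\in\mathcal K$ and any infinite subset $C\subseteq H$ there is a subgroup $K\le H$ which, with the metric of $H$, belongs to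 $\mathcal K$, such that $C\subseteq K$ and $C$ and $K$ have the same density character (the smallest cardinality of a dense subset). **Proposition 1.5.** (a) The class of discrete groups in $\mathbf{OB}$, the class of discrete groups in $\mathbf{FH}$ and the class of discrete groups in $\mathbf{F}\mathbb{R}$ are not bountiful: none of the three is. (b) The class of discrete groups that are non-$\mathbf{OB}$, the class of discrete groups that are non-$\mathbf{FH}$ and the class of discrete groups that are non-$\mathbf{F}\mathbb{R}$ are all bountiful. Moreover, for every bound $D\in(0,\infty]$, statements (a) and (b) also hold with "discrete groups" replaced by "metric groups that are continuous structures". -/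

import Mathlib

open Set Cardinal
open scoped ENNReal

universe u

noncomputable section

/-- `[0, dist x y] → X` is a geodesic path from `x` to `y`: an isometric map from a closed interval
`[0, l]` sending `0` to `x` and `l` to `y`.  Being isometric forces `l = dist x y`. -/
structure IsGeodesicPath {X : Type*} [MetricSpace X] (x y : X)
    (ρ : Icc (0 : ℝ) (dist x y) → X) : Prop where
  isometry : Isometry ρ
  source : ρ ⟨0, le_refl 0, dist_nonneg⟩ = x
  target : ρ ⟨dist x y, dist_nonneg, le_refl _⟩ = y

/-- The segment `[x, y]`: the points on a geodesic path from `x` to `y`.  In a uniquely geodesic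
space it is the image of the only such path. -/
def geodesicSegment {X : Type*} [MetricSpace X] (x y : X) : Set X :=
  {z | ∃ ρ : Icc (0 : ℝ) (dist x y) → X, IsGeodesicPath x y ρ ∧ z ∈ range ρ}

/-- A real tree: a nonempty uniquely geodesic metric space in which two segments that meet only in
their common endpoint together form a segment.  Completeness is not required. -/
structure IsRealTree (X : Type*) [MetricSpace X] : Prop where
  nonempty : Nonempty X
  uniquely_geodesic : ∀ x y : X, ∃! ρ : Icc (0 : ℝ) (dist x y) → X, IsGeodesicPath x y ρ
  union_segments : ∀ x y z : X, geodesicSegment y x ∩ geodesicSegment x z = {x} →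
    geodesicSegment y x ∪ geodesicSegment x z = geodesicSegment y z

/-- A property of topological groups. -/
abbrev TopGroupProperty : Type (u + 1) :=
  ∀ (G : Type u) [Group G] [TopologicalSpace G], Prop

/-- Property **OB**: for every continuous isometric action on a metric space all orbits are
bounded.  (Spaces in the universe of `G` suffice: an orbit of `G` is a quotient of `G`.) -/
def PropertyOB : TopGroupProperty.{u} := fun G _ _ =>
  ∀ (X : Type u) [MetricSpace X] [MulAction G X] [IsIsometricSMul G X] [ContinuousSMul G X],
    ∀ x : X, Bornology.IsBounded (MulAction.orbit G x)

/-- Property **FH**: every continuous affine isometric action on a real Hilbert space has a fixed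
point.  (Spaces in the universe of `G` suffice: pass to the closed linear span of an orbit.) -/
def PropertyFH : TopGroupProperty.{u} := fun G _ _ =>
  ∀ (E : Type u) [NormedAddCommGroup E] [InnerProductSpace ℝ E] [CompleteSpace E]
    (α : G →* (E ≃ᵃⁱ[ℝ] E)), Continuous (fun p : G × E => α p.1 p.2) →
    ∃ x : E, ∀ g : G, α g x = x

/-- Property **Fℝ**: every continuous isometric action on a real tree has a fixed point.
(Trees in the universe of `G` suffice: pass to the subtree spanned by an orbit.) -/
def PropertyFR : TopGroupProperty.{u} := fun G _ _ =>
  ∀ (X : Type u) [MetricSpace X] [MulAction G X] [IsIsometricSMul G X] [ContinuousSMul G X],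
    IsRealTree X → ∃ x : X, ∀ g : G, g • x = x

/-- The complementary property. -/
def TopGroupProperty.Non (P : TopGroupProperty.{u}) : TopGroupProperty.{u} :=
  fun G _ _ => ¬ P G

/-- The class of discrete groups with property `P` is bountiful: for all infinite groups `G ≤ H`
with `H` in the class there is `K` in the class with `G ≤ K ≤ H` and `|G| = |K|`.  Abstract groups
carry the discrete topology `⊥`. -/
def TopGroupProperty.BountifulDiscrete (P : TopGroupProperty.{u}) : Prop :=
  ∀ (H : Type u) [Group H], @P H _ ⊥ →
    ∀ G : Subgroup H, Infinite G →
      ∃ K : Subgroup H, @P K _ ⊥ ∧ G ≤ K ∧ #G = #K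

/-- The density character: the least cardinality of a dense subset. -/
def densityCharacter (X : Type u) [TopologicalSpace X] : Cardinal.{u} :=
  sInf {κ | ∃ s : Set X, Dense s ∧ #s = κ}

/-- A metric group that is a continuous structure, with metric bounded by `D`: the metric is
complete, bi-invariant and at most `D` (for `D = ∞` there is no bound). -/
structure IsContinuousMetricGroup (D : ℝ≥0∞) (G : Type*) [Group G] [MetricSpace G] : Prop where
  complete : CompleteSpace G
  dist_mul_left : ∀ a x y : G, dist (a * x) (a * y) = dist x y
  dist_mul_right : ∀ a x y : G, dist (x * a) (y * a) = dist x y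
  edist_le : ∀ x y : G, edist x y ≤ D

/-- The class of those metric groups that are continuous structures with metric bounded by `D` and
that have property `P` is bountiful: for every infinite `H` in the class and every infinite subset
`C` of `H` there is a subgroup `K` of `H`, in the class with the metric of `H`, that contains `C`
and has the same density character as `C`. -/
def TopGroupProperty.BountifulMetric (D : ℝ≥0∞) (P : TopGroupProperty.{u}) : Prop :=
  ∀ (H : Type u) [Group H] [MetricSpace H], Infinite H → IsContinuousMetricGroup D H → P H →
    ∀ C : Set H, C.Infinite →
      ∃ K : Subgroup H, IsContinuousMetricGroup D K ∧ P K ∧ C ⊆ (K : Set H) ∧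
        densityCharacter C = densityCharacter K

end

/-! Negative half: the power of the alternating group on five letters over `ℕ` is locally finite,
yet all its length functions are bounded (`lengthBounded_pi`). Bounded lengths give bounded orbits,
hence fixed points in Hilbert spaces (circumcentres) and, by `LengthBounded.exists_fixed_realTree`,
even in incomplete real trees. A bountiful class would therefore contain a countably infinite
subgroup of this group. Such a subgroup is an increasing union of finite subgroups, so it has a
proper ultrametric length, and this length produces an affine action on `ℓ²` and an action on a
tree, both without fixed points. For metric groups the same example carries a discrete metric.

Positive half: each failure is forced by countably many elements (`CountablyWitnessed`), and
adjoining these to an infinite group or set does not change its cardinality or density character.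
Unbounded orbits clearly have such witnesses. The delicate case is a fixed-point-free action on an
incomplete tree with bounded orbits: the witnesses then approximate the supremum `D` of the
displacements of a point `x`. If they fixed a point `p`, the point of `[x, p]` at distance `D / 2`
from `x` would be fixed by the whole group (`IsRealTree.exists_fixed_of_approx`). -/

/-! ### Real trees and the four-point condition. -/

/-- The four-point condition (`0`-hyperbolicity). -/
def FourPoint (X : Type*) [MetricSpace X] : Prop :=
  ∀ x y z w : X, dist x y + dist z w ≤ max (dist x z + dist y w) (dist x w + dist y z)

/-- `p` lies metrically between `x` and `y`. -/
def MetricBtw {X : Type*} [MetricSpace X] (x p y : X) : Prop := dist x p + dist p y = dist x y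

section RealTree

variable {X : Type*} [MetricSpace X]

/-- If a 1-Lipschitz path shortened any subinterval, the triangle inequality would put its end
points too close together. -/
theorem isGeodesicPath_of_lipschitz {x y : X} (f : ℝ → X) (h0 : f 0 = x) (h1 : f (dist x y) = y)
    (hf : ∀ s t, 0 ≤ s → s ≤ t → t ≤ dist x y → dist (f s) (f t) ≤ t - s) :
    IsGeodesicPath x y (fun t : Icc (0 : ℝ) (dist x y) => f t) := by
  have key : ∀ s t, 0 ≤ s → s ≤ t → t ≤ dist x y → dist (f s) (f t) = t - s := by
    intro s t hs hst ht
    refine le_antisymm (hf s t hs hst ht) ?_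
    have a := hf 0 s le_rfl hs (hst.trans ht)
    have b := hf t (dist x y) (hs.trans hst) ht le_rfl
    rw [h0] at a
    rw [h1] at b
    linarith [dist_triangle4 x (f s) (f t) y]
  refine ⟨Isometry.of_dist_eq fun s t => ?_, h0, h1⟩
  rw [Subtype.dist_eq, Real.dist_eq]
  rcases le_total s.1 t.1 with h | h
  · rw [key _ _ s.2.1 h t.2.2, abs_sub_comm, abs_of_nonneg (by linarith)]
  · rw [dist_comm, key _ _ t.2.1 h s.2.2, abs_of_nonneg (by linarith)]

theorem IsGeodesicPath.dist_source {x y : X} {ρ : Icc (0 : ℝ) (dist x y) → X}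
    (h : IsGeodesicPath x y ρ) (t : Icc (0 : ℝ) (dist x y)) : dist x (ρ t) = t := by
  conv_lhs => rw [← h.source]
  rw [h.isometry.dist_eq, Subtype.dist_eq, Real.dist_eq, zero_sub, abs_neg, abs_of_nonneg t.2.1]

theorem IsGeodesicPath.dist_target {x y : X} {ρ : Icc (0 : ℝ) (dist x y) → X}
    (h : IsGeodesicPath x y ρ) (t : Icc (0 : ℝ) (dist x y)) :
    dist (ρ t) y = dist x y - t := by
  conv_lhs => rw [← h.target]
  rw [h.isometry.dist_eq, Subtype.dist_eq, Real.dist_eq, abs_sub_comm,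
    abs_of_nonneg (by linarith [t.2.2])]

theorem geodesicSegment_subset_btw {x y z : X} (h : z ∈ geodesicSegment x y) : MetricBtw x z y := by
  obtain ⟨ρ, hρ, t, rfl⟩ := h
  rw [MetricBtw, hρ.dist_source, hρ.dist_target]
  ring

/-- A geodesic path through a given point that is metrically between the end points. -/
theorem exists_geodesic_through (hX : IsRealTree X) {x a y : X} (h : MetricBtw x a y) :
    ∃ ρ : Icc (0 : ℝ) (dist x y) → X, IsGeodesicPath x y ρ ∧
      ∀ ht : dist x a ∈ Icc (0 : ℝ) (dist x y), ρ ⟨dist x a, ht⟩ = a := by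
  obtain ⟨ρ, hρ, -⟩ := hX.uniquely_geodesic x a
  obtain ⟨σ, hσ, -⟩ := hX.uniquely_geodesic a y
  unfold MetricBtw at h
  set f : ℝ → X := fun t => if t ≤ dist x a then IccExtend dist_nonneg ρ t
    else IccExtend dist_nonneg σ (t - dist x a) with hf
  have f1 : ∀ t, ∀ h0 : 0 ≤ t, ∀ h1 : t ≤ dist x a, f t = ρ ⟨t, h0, h1⟩ := by
    intro t h0 h1
    simp only [hf, if_pos h1]
    exact IccExtend_of_mem _ _ ⟨h0, h1⟩
  have fa : f (dist x a) = a := by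
    rw [f1 _ dist_nonneg le_rfl]; exact hρ.target
  have f2 : ∀ t, ∀ h0 : dist x a ≤ t, ∀ h1 : t ≤ dist x y,
      f t = σ ⟨t - dist x a, by linarith, by linarith⟩ := by
    intro t h0 h1
    rcases h0.eq_or_lt with h2 | h2
    · subst h2
      rw [fa]
      simp only [sub_self]
      exact hσ.source.symm
    · simp only [hf, if_neg (not_le.2 h2)]
      exact IccExtend_of_mem _ _ ⟨by linarith, by linarith⟩
  have da : ∀ t, 0 ≤ t → t ≤ dist x a → dist (f t) a = dist x a - t := by
    intro t h0 h1
    rw [f1 t h0 h1, hρ.dist_target]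
  have db : ∀ t, dist x a ≤ t → t ≤ dist x y → dist a (f t) = t - dist x a := by
    intro t h0 h1
    rw [f2 t h0 h1, hσ.dist_source]
  refine ⟨fun t => f t, isGeodesicPath_of_lipschitz f ?_ ?_ ?_, fun _ => fa⟩
  · rw [f1 0 le_rfl dist_nonneg]; exact hρ.source
  · rw [f2 _ (by linarith [dist_nonneg (x := a) (y := y)]) le_rfl]
    have := hσ.dist_target ⟨dist x y - dist x a,
      by linarith [dist_nonneg (x := a) (y := y)], by linarith⟩
    rw [← dist_eq_zero, this]
    simp only
    linarith
  · intro s t hs hst ht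
    rcases le_total t (dist x a) with h1 | h1
    · rw [f1 s hs (hst.trans h1), f1 t (hs.trans hst) h1, hρ.isometry.dist_eq, Subtype.dist_eq,
        Real.dist_eq, abs_sub_comm, abs_of_nonneg (by simpa using hst)]
    · rcases le_total s (dist x a) with h2 | h2
      -- Across the junction `a` only the Lipschitz bound is needed, and it is the triangle
      -- inequality through `a`.
      · linarith [dist_triangle (f s) a (f t), da s hs h2, db t h1 ht]
      · rw [f2 s h2 (hst.trans ht), f2 t h1 ht, hσ.isometry.dist_eq, Subtype.dist_eq,
          Real.dist_eq, abs_sub_comm, abs_of_nonneg (by simpa using hst)]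
        simp

theorem IsRealTree.mem_geodesicSegment (hX : IsRealTree X) {x z y : X} :
    z ∈ geodesicSegment x y ↔ MetricBtw x z y := by
  refine ⟨geodesicSegment_subset_btw, fun h => ?_⟩
  obtain ⟨ρ, hρ, h1⟩ := exists_geodesic_through hX h
  have ht : dist x z ∈ Icc (0 : ℝ) (dist x y) :=
    ⟨dist_nonneg, by unfold MetricBtw at h; linarith [dist_nonneg (x := z) (y := y)]⟩
  exact ⟨ρ, hρ, ⟨_, ht⟩, h1 ht⟩

theorem IsRealTree.btw_unique (hX : IsRealTree X) {x a b y : X} (ha : MetricBtw x a y)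
    (hb : MetricBtw x b y)
    (hab : dist x a = dist x b) : a = b := by
  obtain ⟨ρ, hρ, h1⟩ := exists_geodesic_through hX ha
  obtain ⟨σ, hσ, h2⟩ := exists_geodesic_through hX hb
  have hs : ρ = σ := (hX.uniquely_geodesic x y).unique hρ hσ
  have ht : dist x a ∈ Icc (0 : ℝ) (dist x y) :=
    ⟨dist_nonneg, by unfold MetricBtw at ha; linarith [dist_nonneg (x := a) (y := y)]⟩
  rw [← h1 ht, ← h2 (hab ▸ ht), hs]
  congr 2

theorem IsRealTree.exists_dist_eq (hX : IsRealTree X) (x y : X) {t : ℝ} (h0 : 0 ≤ t)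
    (h1 : t ≤ dist x y) : ∃ p, dist x p = t ∧ dist p y = dist x y - t := by
  obtain ⟨ρ, hρ, -⟩ := hX.uniquely_geodesic x y
  exact ⟨ρ ⟨t, h0, h1⟩, hρ.dist_source _, hρ.dist_target _⟩

theorem IsRealTree.isCompact_geodesicSegment (hX : IsRealTree X) (x y : X) :
    IsCompact (geodesicSegment x y) := by
  obtain ⟨ρ, hρ, hu⟩ := hX.uniquely_geodesic x y
  have : geodesicSegment x y = range ρ := by
    ext z
    constructor
    · rintro ⟨σ, hσ, hz⟩
      rwa [hu σ hσ] at hz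
    · exact fun hz => ⟨ρ, hρ, hz⟩
  rw [this]
  exact isCompact_range hρ.isometry.continuous

theorem MetricBtw.symm {x p y : X} (h : MetricBtw x p y) : MetricBtw y p x := by
  unfold MetricBtw at *
  rw [dist_comm y p, dist_comm p x, dist_comm y x]
  linarith

theorem btw_left (x y : X) : MetricBtw x x y := by simp [MetricBtw]

theorem btw_right (x y : X) : MetricBtw x y y := by simp [MetricBtw]

theorem MetricBtw.trans {x p q y : X} (h : MetricBtw x p y) (h' : MetricBtw p q y) :
    MetricBtw x q y ∧ dist x q = dist x p + dist p q := by
  unfold MetricBtw at *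
  constructor <;> linarith [dist_triangle x p q, dist_triangle x q y]

/-- Three points of a real tree are the end points of a tripod. -/
theorem IsRealTree.exists_center (hX : IsRealTree X) (x y z : X) :
    ∃ p, MetricBtw x p y ∧ MetricBtw x p z ∧ MetricBtw y p z := by
  have hc : IsCompact (geodesicSegment x y ∩ geodesicSegment x z) :=
    (hX.isCompact_geodesicSegment x y).inter (hX.isCompact_geodesicSegment x z)
  -- The branch point is the common point of the two segments farthest from `x`. By maximality `[y,
  -- p]` and `[p, z]` meet only in `p`, so the tree axiom joins them.
  obtain ⟨p, ⟨hp1, hp2⟩, hmax⟩ := hc.exists_isMaxOn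
    ⟨x, hX.mem_geodesicSegment.2 (btw_left _ _), hX.mem_geodesicSegment.2 (btw_left _ _)⟩
    (f := fun q => dist x q) (by fun_prop)
  rw [hX.mem_geodesicSegment] at hp1 hp2
  refine ⟨p, hp1, hp2, ?_⟩
  have h := hX.union_segments p y z ?_
  · rw [← hX.mem_geodesicSegment, ← h]
    exact Or.inl (hX.mem_geodesicSegment.2 (btw_right _ _))
  · ext q
    simp only [mem_inter_iff, hX.mem_geodesicSegment, mem_singleton_iff]
    constructor
    · rintro ⟨h1, h2⟩
      obtain ⟨h3, h4⟩ := hp1.trans h1.symm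
      obtain ⟨h5, -⟩ := hp2.trans h2
      have : dist x q ≤ dist x p :=
        hmax ⟨hX.mem_geodesicSegment.2 h3, hX.mem_geodesicSegment.2 h5⟩
      exact (dist_le_zero.1 (by linarith)).symm
    · rintro rfl
      exact ⟨btw_right _ _, btw_left _ _⟩

/-- The branch points `a` and `b` of the tripods `w, x, y` and `w, y, z` both lie on `[w, y]`. The
one nearer to `w` also lies on the segment from `w` to the third point, and going through it gives
the inequality. -/
theorem IsRealTree.fourPoint (hX : IsRealTree X) : FourPoint X := by
  have aux : ∀ {w y z a b : X}, MetricBtw w a y → MetricBtw w b y → MetricBtw w b z →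
      dist w a ≤ dist w b →
      MetricBtw w a z := by
    intro w y z a b ha hb hbz hab
    obtain ⟨a', h1, h2⟩ := hX.exists_dist_eq w b dist_nonneg hab
    have h3 : MetricBtw w a' b := by rw [MetricBtw, h1, h2]; ring
    obtain ⟨h4, -⟩ := hb.symm.trans h3.symm
    obtain ⟨h5, -⟩ := hbz.symm.trans h3.symm
    rw [hX.btw_unique ha h4.symm h1.symm]
    exact h5.symm
  intro x z y w
  obtain ⟨a, ha1, ha2, ha3⟩ := hX.exists_center w x y
  obtain ⟨b, hb1, hb2, hb3⟩ := hX.exists_center w y z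
  rcases le_total (dist w a) (dist w b) with h | h
  · have := aux ha2 hb1 hb2 h
    refine le_max_of_le_left ?_
    unfold MetricBtw at *
    linarith [dist_triangle x a z, dist_comm w x, dist_comm w y, dist_comm w z, dist_comm x a]
  · have := aux hb1 ha2 ha1 h
    refine le_max_of_le_right ?_
    unfold MetricBtw at *
    linarith [dist_triangle x b z, dist_comm w x, dist_comm w y, dist_comm w z, dist_comm x b,
      dist_comm z y, dist_comm b y]

/-- Points between `x` and `y` are thus determined by their distance from `x`, which makes geodesics
unique. -/
theorem FourPoint.dist_le_of_btw (hX : FourPoint X) {x y p q : X} (hp : MetricBtw x p y)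
    (hq : MetricBtw x q y) : dist p q ≤ |dist x p - dist x q| := by
  have h := hX p q x y
  unfold MetricBtw at *
  rcases le_max_iff.1 h with h | h
  · exact le_trans (by linarith [dist_comm x p]) (le_abs_self _)
  · exact le_trans (by linarith [dist_comm x q]) (neg_le_abs _)

/-- A four-point space with points at every distance along each pair is a real tree. -/
theorem isRealTree_of_fourPoint [Nonempty X] (hX : FourPoint X)
    (hE : ∀ x y : X, ∀ t, 0 ≤ t → t ≤ dist x y → ∃ p, dist x p = t ∧ dist p y = dist x y - t) :
    IsRealTree X := by
  have hex : ∀ x y : X, ∃ ρ : Icc (0 : ℝ) (dist x y) → X, IsGeodesicPath x y ρ := by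
    intro x y
    have : ∀ t, ∃ p, 0 ≤ t → t ≤ dist x y → dist x p = t ∧ dist p y = dist x y - t := by
      intro t
      by_cases h : 0 ≤ t ∧ t ≤ dist x y
      · obtain ⟨p, hp⟩ := hE x y t h.1 h.2
        exact ⟨p, fun _ _ => hp⟩
      · exact ⟨x, fun h0 h1 => absurd ⟨h0, h1⟩ h⟩
    choose f hf using this
    have hb : ∀ t, 0 ≤ t → t ≤ dist x y → MetricBtw x (f t) y := by
      intro t h0 h1
      rw [MetricBtw, (hf t h0 h1).1, (hf t h0 h1).2]; ring
    refine ⟨fun t => f t, isGeodesicPath_of_lipschitz f ?_ ?_ ?_⟩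
    · exact (dist_eq_zero.1 (hf 0 le_rfl dist_nonneg).1).symm
    · exact dist_eq_zero.1 (by rw [(hf _ dist_nonneg le_rfl).2, sub_self])
    · intro s t hs hst ht
      refine (hX.dist_le_of_btw (hb s hs (hst.trans ht)) (hb t (hs.trans hst) ht)).trans_eq ?_
      rw [(hf s hs (hst.trans ht)).1, (hf t (hs.trans hst) ht).1, abs_sub_comm,
        abs_of_nonneg (by linarith)]
  have hseg : ∀ x y z : X, z ∈ geodesicSegment x y ↔ MetricBtw x z y := by
    intro x y z
    refine ⟨geodesicSegment_subset_btw, fun h => ?_⟩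
    obtain ⟨ρ, hρ⟩ := hex x y
    have ht : dist x z ≤ dist x y := by
      unfold MetricBtw at h; linarith [dist_nonneg (x := z) (y := y)]
    have hb : MetricBtw x (ρ ⟨dist x z, dist_nonneg, ht⟩) y := by
      rw [MetricBtw, hρ.dist_source, hρ.dist_target]; ring
    have := hX.dist_le_of_btw hb h
    rw [hρ.dist_source, sub_self, abs_zero] at this
    exact ⟨ρ, hρ, _, dist_le_zero.1 this⟩
  refine ⟨inferInstance, fun x y => ?_, fun x y z h => ?_⟩
  · obtain ⟨ρ, hρ⟩ := hex x y
    refine ⟨ρ, hρ, fun σ hσ => funext fun t => ?_⟩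
    have := hX.dist_le_of_btw (x := x) (y := y) (p := σ t) (q := ρ t)
      (by rw [MetricBtw, hσ.dist_source, hσ.dist_target]; ring)
      (by rw [MetricBtw, hρ.dist_source, hρ.dist_target]; ring)
    rw [hρ.dist_source, hσ.dist_source, sub_self, abs_zero] at this
    exact dist_le_zero.1 this
  · have hyxz : MetricBtw y x z := by
      -- The distance is the Gromov product of `y` and `z` at `x`; the four-point condition puts `p`
      -- on both segments, so `p = x` and the product vanishes.
      obtain ⟨p, h1, h2⟩ := hE x y ((dist x y + dist x z - dist y z) / 2)
        (by linarith [dist_triangle y x z, dist_comm x y])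
        (by linarith [dist_triangle x y z, dist_comm x y])
      have h4 : MetricBtw x p y := by rw [MetricBtw, h1, h2]; ring
      have h5 : MetricBtw x p z := by
        have := hX p z x y
        unfold MetricBtw
        rcases le_max_iff.1 this with h6 | h6 <;>
        linarith [dist_triangle x p z, dist_comm x p, dist_comm z y, dist_comm z x]
      have : p ∈ ({x} : Set X) := by
        rw [← h]
        exact ⟨(hseg _ _ _).2 h4.symm, (hseg _ _ _).2 h5⟩
      rw [mem_singleton_iff.1 this, dist_self] at h1
      unfold MetricBtw
      linarith [dist_comm x y]
    ext w
    simp only [mem_union, hseg]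
    constructor
    · rintro (h1 | h1)
      · exact (hyxz.symm.trans h1.symm).1.symm
      · exact (hyxz.trans h1).1
    · intro h1
      have h2 := hX.dist_le_of_btw h1 hyxz
      unfold MetricBtw at *
      rcases abs_cases (dist y w - dist y x) with ⟨h3, h4⟩ | ⟨h3, h4⟩
      · right
        linarith [dist_triangle x w z, dist_comm x w]
      · left
        linarith [dist_triangle y w x, dist_comm x w]

end RealTree

/-! ### Length functions, bounded orbits and fixed points in trees. -/

/-- Every length function on the group is bounded. -/
def LengthBounded (G : Type*) [Group G] : Prop :=
  ∀ L : G → ℝ, L 1 = 0 → (∀ g, L g⁻¹ = L g) → (∀ g h, L (g * h) ≤ L g + L h) → ∃ B, ∀ g, L g ≤ B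

section Orbits

variable {G X : Type*} [Group G] [MetricSpace X] [MulAction G X]

theorem isBounded_orbit_iff (x : X) :
    Bornology.IsBounded (MulAction.orbit G x) ↔ ∃ B, ∀ g : G, dist x (g • x) ≤ B := by
  rw [Metric.isBounded_iff_subset_closedBall x]
  refine exists_congr fun B => ?_
  constructor
  · intro h g
    rw [dist_comm]
    exact h ⟨g, rfl⟩
  · rintro h _ ⟨g, rfl⟩
    rw [Metric.mem_closedBall, dist_comm]
    exact h g

variable [IsIsometricSMul G X]

theorem dist_smul_inv (x : X) (g : G) : dist x (g⁻¹ • x) = dist x (g • x) := by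
  rw [← dist_smul g x, smul_inv_smul, dist_comm]

theorem dist_smul_mul_le (x : X) (g h : G) :
    dist x ((g * h) • x) ≤ dist x (g • x) + dist x (h • x) := by
  refine (dist_triangle x (g • x) _).trans ?_
  rw [mul_smul, dist_smul]

theorem dist_smul_smul (x : X) (g h : G) : dist (g • x) (h • x) = dist x ((g⁻¹ * h) • x) := by
  rw [← dist_smul g x, smul_smul, mul_inv_cancel_left]

theorem LengthBounded.isBounded_orbit (hG : LengthBounded G) (x : X) :
    ∃ B, ∀ g : G, dist x (g • x) ≤ B :=
  hG (fun g => dist x (g • x)) (by simp) (dist_smul_inv x) (dist_smul_mul_le x)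

/-- The tree analogue of the parallelogram law; it replaces completeness in the search for a
circumcentre. -/
theorem FourPoint.dist_midpoint_le (hX : FourPoint X) {y z m : X} (h1 : dist y m = dist y z / 2)
    (h2 : dist m z = dist y z / 2) (p : X) :
    dist p m ≤ max (dist p y) (dist p z) - dist y z / 2 := by
  have h := hX p m y z
  rcases le_max_iff.1 h with h | h
  · linarith [le_max_left (dist p y) (dist p z)]
  · linarith [le_max_right (dist p y) (dist p z), dist_comm y m]

/-- The midpoint of `x` and `g • x` is close to every point of the orbit's sphere if `g` almost
realises the diameter of the orbit of `x`. -/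
theorem FourPoint.dist_midpoint_smul_le (hX : FourPoint X) {x m : X} {g : G} {D : ℝ}
    (hD : ∀ h : G, dist x (h • x) ≤ D) (h1 : dist x m = dist x (g • x) / 2)
    (h2 : dist m (g • x) = dist x (g • x) / 2) (h : G) :
    dist (h • x) m ≤ D - dist x (g • x) / 2 := by
  refine (hX.dist_midpoint_le h1 h2 (h • x)).trans ?_
  gcongr
  refine max_le ?_ ?_
  · rw [dist_comm]; exact hD h
  · rw [dist_smul_smul]; exact hD _

/-- Such a midpoint is almost fixed. -/
theorem FourPoint.dist_smul_midpoint_le (hX : FourPoint X) {x m : X} {g : G} {D : ℝ}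
    (hD : ∀ h : G, dist x (h • x) ≤ D) (h1 : dist x m = dist x (g • x) / 2)
    (h2 : dist m (g • x) = dist x (g • x) / 2) (h : G) :
    dist m (h • m) ≤ D - dist x (g • x) := by
  have a := hX.dist_midpoint_le h1 h2 (h • m)
  have b : ∀ k : G, dist (h • m) (k • x) ≤ D - dist x (g • x) / 2 := by
    intro k
    rw [← dist_smul h⁻¹, inv_smul_smul, smul_smul, dist_comm]
    exact hX.dist_midpoint_smul_le hD h1 h2 _
  have c : max (dist (h • m) x) (dist (h • m) (g • x)) ≤ D - dist x (g • x) / 2 :=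
    max_le (by simpa using b 1) (b g)
  rw [dist_comm]
  linarith

theorem IsRealTree.exists_midpoint (hX : IsRealTree X) (x y : X) :
    ∃ m, dist x m = dist x y / 2 ∧ dist m y = dist x y / 2 := by
  have := dist_nonneg (x := x) (y := y)
  obtain ⟨m, h1, h2⟩ := hX.exists_dist_eq x y (t := dist x y / 2) (by linarith) (by linarith)
  exact ⟨m, h1, by linarith⟩

/-- A bounded orbit that attains its diameter yields a fixed point. -/
theorem IsRealTree.exists_fixed_of_attained (hX : IsRealTree X) {x : X} {g : G}
    (h : ∀ k : G, dist x (k • x) ≤ dist x (g • x)) : ∃ m : X, ∀ k : G, k • m = m := by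
  obtain ⟨m, h1, h2⟩ := hX.exists_midpoint x (g • x)
  refine ⟨m, fun k => ?_⟩
  have := hX.fourPoint.dist_smul_midpoint_le h h1 h2 k
  rw [sub_self] at this
  exact (dist_le_zero.1 this).symm

/-- A bounded orbit in a real tree is ultrametric if its diameter is approximated. -/
theorem IsRealTree.orbit_ultrametric (hX : IsRealTree X) {x : X} {D : ℝ}
    (hD : ∀ h : G, dist x (h • x) ≤ D) (hs : ∀ ε > 0, ∃ g : G, D - ε < dist x (g • x)) (g h : G) :
    dist x ((g * h) • x) ≤ max (dist x (g • x)) (dist x (h • x)) := by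
  refine le_of_forall_pos_le_add fun ε hε => ?_
  obtain ⟨k, hk⟩ := hs (ε / 4) (by linarith)
  obtain ⟨m, h1, h2⟩ := hX.exists_midpoint x (k • x)
  -- All orbit points are at distance about `D / 2` from `m`, so in the four-point condition with
  -- `m` these distances cancel up to `ε`.
  have up := hX.fourPoint.dist_midpoint_smul_le hD h1 h2
  have low : ∀ a : G, D / 2 - ε / 2 ≤ dist (a • x) m := by
    intro a
    have e : dist (a • x) ((a * k) • x) = dist x (k • x) := by rw [mul_smul, dist_smul]
    linarith [dist_triangle (a • x) m ((a * k) • x), up (a * k), dist_comm m ((a * k) • x)]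
  have f := hX.fourPoint x ((g * h) • x) (g • x) m
  have e : dist ((g * h) • x) (g • x) = dist x (h • x) := by
    rw [dist_comm, mul_smul, dist_smul]
  rw [e] at f
  have u1 := up (g * h)
  have u0 := up 1
  rw [one_smul] at u0
  have l := low g
  rcases le_max_iff.1 f with f | f
  · linarith [le_max_left (dist x (g • x)) (dist x (h • x))]
  · linarith [le_max_right (dist x (g • x)) (dist x (h • x))]

/-- If the supremum `D` of the displacements `d` is attained, a midpoint is fixed. If not, `d` is
ultrametric, so its increasing function `d / (D - d)` is again a length function, and an unbounded
one. -/
theorem LengthBounded.exists_fixed_realTree (hG : LengthBounded G) (hX : IsRealTree X) :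
    ∃ x : X, ∀ g : G, g • x = x := by
  obtain ⟨x⟩ := hX.nonempty
  set D := ⨆ g : G, dist x (g • x)
  have hb : BddAbove (range fun g : G => dist x (g • x)) := by
    obtain ⟨B, hB⟩ := hG.isBounded_orbit x
    exact ⟨B, by rintro _ ⟨g, rfl⟩; exact hB g⟩
  have hD : ∀ g : G, dist x (g • x) ≤ D := fun g => le_ciSup hb g
  by_cases hatt : ∃ g : G, D ≤ dist x (g • x)
  · obtain ⟨g, hg⟩ := hatt
    exact hX.exists_fixed_of_attained fun k => (hD k).trans hg
  push Not at hatt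
  have hs : ∀ ε > 0, ∃ g : G, D - ε < dist x (g • x) := fun ε hε =>
    exists_lt_of_lt_ciSup (by linarith)
  have um := hX.orbit_ultrametric hD hs
  have hpos : 0 < D := by simpa using hatt 1
  have sub : ∀ g : G, 0 < D - dist x (g • x) := fun g => sub_pos.2 (hatt g)
  have mono : ∀ g h : G, dist x (g • x) ≤ dist x (h • x) →
      dist x (g • x) / (D - dist x (g • x)) ≤ dist x (h • x) / (D - dist x (h • x)) :=
    fun g h hgh => div_le_div₀ dist_nonneg hgh (sub h) (by linarith)
  obtain ⟨B, hB⟩ := hG (fun g => dist x (g • x) / (D - dist x (g • x))) (by simp)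
    (fun g => by simp only [dist_smul_inv]) (fun g h => by
      have hg : 0 ≤ dist x (g • x) / (D - dist x (g • x)) := div_nonneg dist_nonneg (sub g).le
      have hh : 0 ≤ dist x (h • x) / (D - dist x (h • x)) := div_nonneg dist_nonneg (sub h).le
      rcases le_max_iff.1 (um g h) with h1 | h1
      · linarith [mono _ _ h1]
      · linarith [mono _ _ h1])
  have hB0 : 0 ≤ B := by simpa using hB 1
  -- The quotient exceeds `B` as soon as `D - d < D / (1 + B)`.
  obtain ⟨g, hg⟩ := hs (D / (1 + B)) (by positivity)
  have h1 := hB g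
  rw [div_le_iff₀ (sub g)] at h1
  have h2 : (D - dist x (g • x)) * (1 + B) < D := by
    rw [← lt_div_iff₀ (by positivity)]; linarith
  linarith

/-- The midpoints of `x` and `g n • x`, where `g n • x` approaches the diameter of the bounded
orbit of `x`, accumulate at a common fixed point as soon as all `g n` lie in a subgroup that fixes
a point. -/
theorem IsRealTree.exists_fixed_of_approx (hX : IsRealTree X) {x p : X} {D : ℝ}
    (hD : ∀ h : G, dist x (h • x) ≤ D)
    (hs : ∀ ε > 0, ∃ g : G, D - ε < dist x (g • x) ∧ g • p = p) :
    ∃ q : X, ∀ g : G, g • q = q := by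
  have hD0 : 0 ≤ D := by simpa using hD 1
  have hp : D / 2 ≤ dist x p := by
    refine le_of_forall_pos_le_add fun ε hε => ?_
    obtain ⟨g, h1, h2⟩ := hs ε hε
    have : dist p (g • x) = dist x p := by
      conv_lhs => rw [← h2, dist_smul, dist_comm]
    linarith [dist_triangle x p (g • x)]
  -- The limit of the midpoints already exists on `[x, p]`, so no completeness is needed.
  obtain ⟨q, q1, q2⟩ := hX.exists_dist_eq x p (by linarith : 0 ≤ D / 2) hp
  refine ⟨q, fun h => (dist_le_zero.1 (le_of_forall_pos_le_add fun ε hε => ?_)).symm⟩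
  obtain ⟨g, h1, h2⟩ := hs (ε / 4) (by linarith)
  obtain ⟨m, m1, m2⟩ := hX.exists_midpoint x (g • x)
  have e : dist p (g • x) = dist p x := by
    conv_lhs => rw [← h2, dist_smul]
  have a := hX.fourPoint.dist_midpoint_le m1 m2 p
  rw [e, max_self] at a
  have b := hX.fourPoint q m x p
  have c := hX.fourPoint.dist_smul_midpoint_le hD m1 m2 h
  have d : dist q m ≤ ε / 4 := by
    rcases le_max_iff.1 b with b | b
    · linarith [dist_comm q x, dist_comm m p, dist_comm p x, hD g]
    · linarith [dist_comm m x, hD g]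
  have f : dist (h • m) (h • q) = dist q m := by rw [dist_smul, dist_comm]
  linarith [dist_triangle4 q m (h • m) (h • q)]

end Orbits

/-! ### Circumcentres in Hilbert spaces. -/

section Hilbert

variable {E : Type*} [NormedAddCommGroup E] [InnerProductSpace ℝ E]

theorem dist_sq_midpoint (p y z : E) : dist (midpoint ℝ y z) p ^ 2 =
    (dist y p ^ 2 + dist z p ^ 2) / 2 - dist y z ^ 2 / 4 := by
  have h := parallelogram_law_with_norm ℝ (y - p) (z - p)
  have e1 : midpoint ℝ y z - p = (2⁻¹ : ℝ) • ((y - p) + (z - p)) := by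
    rw [midpoint_eq_smul_add, invOf_eq_inv]; module
  have e2 : y - z = (y - p) - (z - p) := by abel
  simp only [dist_eq_norm]
  rw [e1, e2, norm_smul, Real.norm_of_nonneg (by norm_num)]
  nlinarith

/-- A group of affine isometries of a Hilbert space with a bounded orbit has a fixed point. -/
theorem exists_fixed_of_bounded [CompleteSpace E] {G : Type*} [Group G] (α : G →* (E ≃ᵃⁱ[ℝ] E))
    (x : E) (hb : ∃ B, ∀ g, dist x (α g x) ≤ B) : ∃ y : E, ∀ g, α g y = y := by
  obtain ⟨B, hB⟩ := hb
  have hmul : ∀ g h y, α (g * h) y = α g (α h y) := fun g h y => by rw [map_mul]; rfl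
  -- `sInf T` is the squared circumradius of the orbit. The sets `S n` of approximate centres are
  -- closed, nested and invariant, and `dist_sq_midpoint` makes their diameters tend to zero.
  set T : Set ℝ := {t | ∃ y : E, ∀ g, dist y (α g x) ^ 2 ≤ t} with hT
  have hTne : T.Nonempty := ⟨B ^ 2, x, fun g => by have := hB g; gcongr⟩
  have hTb : BddBelow T := ⟨0, by rintro t ⟨y, hy⟩; exact (sq_nonneg _).trans (hy 1)⟩
  set r := sInf T with hr
  set S : ℕ → Set E := fun n => {y | ∀ g, dist y (α g x) ^ 2 ≤ r + 1 / (n + 1)} with hS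
  have hne : ∀ n, (S n).Nonempty := by
    intro n
    obtain ⟨t, ⟨y, hy⟩, ht⟩ := exists_lt_of_csInf_lt hTne
      (lt_add_of_pos_right r (Nat.one_div_pos_of_nat (α := ℝ) (n := n)))
    exact ⟨y, fun g => (hy g).trans ht.le⟩
  have hdist : ∀ n, ∀ y ∈ S n, ∀ z ∈ S n, dist y z ^ 2 ≤ 4 * (1 / (n + 1)) := by
    intro n y hy z hz
    have : r ≤ r + 1 / (n + 1) - dist y z ^ 2 / 4 := by
      refine csInf_le hTb ⟨midpoint ℝ y z, fun g => ?_⟩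
      rw [dist_sq_midpoint]
      linarith [hy g, hz g]
    linarith
  have hdist' : ∀ n, ∀ y ∈ S n, ∀ z ∈ S n, dist y z ≤ √(4 * (1 / (n + 1))) :=
    fun n y hy z hz => Real.le_sqrt_of_sq_le (hdist n y hy z hz)
  have hanti : ∀ m n, m ≤ n → S n ⊆ S m := by
    intro m n hmn y hy g
    exact (hy g).trans (by have := Nat.one_div_le_one_div (α := ℝ) hmn; linarith)
  have hlim : Filter.Tendsto (fun n : ℕ => √(4 * (1 / ((n : ℝ) + 1)))) Filter.atTop (nhds 0) := by
    have := ((tendsto_one_div_add_atTop_nhds_zero_nat (𝕜 := ℝ)).const_mul 4).sqrt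
    simpa using this
  have hdiam : Filter.Tendsto (fun n => Metric.diam (S n)) Filter.atTop (nhds 0) :=
    squeeze_zero (fun n => Metric.diam_nonneg)
      (fun n => Metric.diam_le_of_forall_dist_le (Real.sqrt_nonneg _) (hdist' n)) hlim
  obtain ⟨y, hy⟩ := Metric.nonempty_iInter_of_nonempty_biInter (s := S)
    (fun n => by
      simp only [hS, ofPred_forall]
      exact isClosed_iInter fun g => isClosed_le (by fun_prop) continuous_const)
    (fun n => Metric.isBounded_iff.2 ⟨_, fun y hy z hz => hdist' n y hy z hz⟩)
    (fun N => (hne N).mono fun z hz => mem_iInter₂.2 fun n hn => hanti n N hn hz) hdiam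
  rw [mem_iInter] at hy
  refine ⟨y, fun g => ?_⟩
  have hgy : ∀ n, α g y ∈ S n := by
    intro n h
    have : dist (α g y) (α h x) = dist y (α (g⁻¹ * h) x) := by
      rw [← (α g).dist_map y, ← hmul, mul_inv_cancel_left]
    rw [this]
    exact hy n _
  exact dist_le_zero.1 (ge_of_tendsto' hlim fun n => hdist' n _ (hgy n) _ (hy n))

end Hilbert

/-! ### Infinite powers of a finite perfect group. -/

/-- Every finite subset generates a finite subgroup. -/
def LocallyFiniteGroup (G : Type*) [Group G] : Prop :=
  ∀ S : Set G, S.Finite → (Subgroup.closure S : Set G).Finite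

theorem LengthBounded.of_surjective {G H : Type*} [Group G] [Group H] (hG : LengthBounded G)
    (φ : G →* H) (hφ : Function.Surjective φ) : LengthBounded H := by
  intro L h1 hi hm
  obtain ⟨B, hB⟩ := hG (fun g => L (φ g)) (by simpa using h1) (fun g => by simp [hi])
    (fun g h => by simpa using hm (φ g) (φ h))
  exact ⟨B, fun h => by obtain ⟨g, rfl⟩ := hφ h; exact hB g⟩

theorem LocallyFiniteGroup.of_injective {G H : Type*} [Group G] [Group H]
    (hG : LocallyFiniteGroup G) (φ : H →* G) (hφ : Function.Injective φ) :
    LocallyFiniteGroup H := by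
  intro S hS
  have h := hG (φ '' S) (hS.image φ)
  rw [← MonoidHom.map_closure, Subgroup.coe_map] at h
  exact h.of_finite_image hφ.injOn

/-- Finitely many functions into `F` split `I` into finitely many classes on which all of them are
constant, and so is everything they generate. -/
theorem locallyFiniteGroup_pi (I F : Type*) [Group F] [Finite F] :
    LocallyFiniteGroup (I → F) := by
  intro S hS
  have := hS.to_subtype
  let ψ : ((S → F) → F) →* (I → F) :=
    { toFun := fun φ i => φ fun s => s.1 i
      map_one' := rfl
      map_mul' := fun _ _ => rfl }
  have hle : Subgroup.closure S ≤ ψ.range :=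
    (Subgroup.closure_le _).2 fun s hs => ⟨fun v => v ⟨s, hs⟩, rfl⟩
  exact (finite_range ψ).subset hle

section Powers

open scoped commutatorElement

variable {F : Type*} [Group F]

/-- Commutators turn into intersections of supports; this is where perfectness enters the length
estimate. -/
theorem mulIndicator_commutator {I : Type*} (g h : F) (S T : Set I) :
    ⁅S.mulIndicator (fun _ => g), T.mulIndicator (fun _ => h)⁆ =
      (S ∩ T).mulIndicator (fun _ => ⁅g, h⁆) := by
  classical
  ext i
  by_cases hS : i ∈ S <;> by_cases hT : i ∈ T <;>
    simp [commutatorElement_def, hS, hT]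

/-- A nonnegative size function on sets of natural numbers that is compatible with the Boolean
operations up to a constant is bounded. -/
theorem bounded_of_boolean_size (l : Set ℕ → ℝ) (h0 : ∀ S, 0 ≤ l S)
    {K : ℝ} (hK : 0 ≤ K) (hinter : ∀ S T, l (S ∩ T) ≤ K * (l S + l T))
    (hdiff : ∀ A S, S ⊆ A → l (A \ S) ≤ l A + l S)
    (hunion : ∀ S T, l S ≤ l (S ∩ T) + l (S \ T)) : ∃ B, ∀ S, l S ≤ B := by
  by_contra hcon
  push Not at hcon
  -- A set in `U` splits into two parts of large size, one of them again in `U`. Keeping that one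
  -- and discarding the other repeatedly yields disjoint sets `t n` with `n < l (t n)`.
  let U : Set (Set ℕ) := {A | ∀ B, ∃ S ⊆ A, B < l S}
  have step : ∀ (A : U) (n : ℕ), ∃ (A' : U) (s : Set ℕ), A'.1 ⊆ A ∧ s ⊆ A.1 \ A' ∧ n < l s := by
    rintro ⟨A, hA⟩ n
    obtain ⟨S, hSA, hS⟩ := hA (n + l A)
    have hS' : n < l (A \ S) := by
      have := hdiff A (A \ S) sdiff_subset
      rw [sdiff_sdiff_cancel_left hSA] at this
      linarith
    by_cases h1 : S ∈ U
    · exact ⟨⟨S, h1⟩, A \ S, hSA, subset_rfl, hS'⟩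
    · have h2 : A \ S ∈ U := by
        by_contra h2
        simp only [U, mem_ofPred_eq, not_forall, not_exists, not_and, not_lt] at h1 h2
        obtain ⟨B1, h1⟩ := h1
        obtain ⟨B2, h2⟩ := h2
        obtain ⟨T, hT, hB⟩ := hA (B1 + B2)
        linarith [hunion T S, h1 _ (inter_subset_right : T ∩ S ⊆ S),
          h2 _ (sdiff_subset_sdiff_left hT : T \ S ⊆ A \ S)]
      exact ⟨⟨A \ S, h2⟩, S, sdiff_subset, by rw [sdiff_sdiff_cancel_left hSA],
        by linarith [h0 A]⟩
  choose next s hnext hs hsl using step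
  let A : ℕ → U := fun n => Nat.rec ⟨univ, fun B => by
    obtain ⟨S, hS⟩ := hcon B; exact ⟨S, subset_univ _, hS⟩⟩ (fun n A => next A n) n
  have hanti : Antitone fun n => (A n).1 := antitone_nat_of_succ_le fun n => hnext (A n) n
  set t : ℕ → Set ℕ := fun n => s (A n) n with ht
  have htl : ∀ n, n < l (t n) := fun n => hsl _ n
  have hdisj : ∀ m n, m < n → Disjoint (t m) (t n) := by
    intro m n hmn
    rw [Set.disjoint_left]
    intro x hx hx'
    exact (hs (A m) m hx).2 (hanti (Nat.succ_le_of_lt hmn) (hs (A n) n hx').1)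
  have hdisj' : ∀ m n x, x ∈ t m → x ∈ t n → m = n := by
    intro m n x hm hn
    rcases lt_trichotomy m n with h | h | h
    · exact absurd hn (Set.disjoint_left.1 (hdisj _ _ h) hm)
    · exact h
    · exact absurd hm (Set.disjoint_left.1 (hdisj _ _ h) hn)
  -- The pairing function sorts the `t n` into infinitely many blocks `W k`. The set `V` takes from
  -- each block one member that is large compared with `l (W k)`; as it equals `V ∩ W k`, `hinter`
  -- forces `l V > k` for every `k`.
  set W : ℕ → Set ℕ := fun k => ⋃ j, t (Nat.pair k j) with hW
  have hj : ∀ k : ℕ, ∃ j : ℕ, K * (k + l (W k)) < l (t (Nat.pair k j)) := by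
    intro k
    obtain ⟨j, hj⟩ := exists_nat_ge (K * (k + l (W k)))
    refine ⟨j, hj.trans_lt (lt_of_le_of_lt ?_ (htl _))⟩
    exact_mod_cast Nat.right_le_pair k j
  choose j hj using hj
  set V : Set ℕ := ⋃ k, t (Nat.pair k (j k)) with hV
  have hVW : ∀ k, V ∩ W k = t (Nat.pair k (j k)) := by
    intro k
    ext x
    simp only [hV, hW, mem_inter_iff, mem_iUnion]
    constructor
    · rintro ⟨⟨k', hk'⟩, i, hi⟩
      have := hdisj' _ _ _ hk' hi
      rw [Nat.pair_eq_pair] at this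
      rwa [this.1] at hk'
    · exact fun h => ⟨⟨k, h⟩, _, h⟩
  obtain ⟨k, hk⟩ := exists_nat_ge (l V)
  have h1 := hj k
  rw [← hVW k] at h1
  have h2 := hinter V (W k)
  have h3 : K * (l V + l (W k)) ≤ K * (k + l (W k)) := by gcongr
  linarith

/-- An infinite power of a finite perfect group has only bounded length functions. -/
theorem lengthBounded_pi [Finite F] (hF : commutator F = ⊤) : LengthBounded (ℕ → F) := by
  classical
  intro L h1 hi hm
  have := Fintype.ofFinite F
  have hL0 : ∀ x, 0 ≤ L x := fun x => by
    have := hm x x⁻¹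
    rw [mul_inv_cancel, h1, hi] at this
    linarith
  let e : F → Set ℕ → (ℕ → F) := fun g S => S.mulIndicator fun _ => g
  let l : Set ℕ → ℝ := fun S => ∑ g, L (e g S)
  have hl0 : ∀ S, 0 ≤ l S := fun S => Finset.sum_nonneg fun g _ => hL0 _
  have hel : ∀ g S, L (e g S) ≤ l S := fun g S =>
    Finset.single_le_sum (f := fun g => L (e g S)) (fun g _ => hL0 _) (Finset.mem_univ g)
  -- Since `F` is perfect, `f` is a product of commutators and their inverses, and each commutator
  -- costs a factor 2.
  have hcomm : ∀ f : F, ∃ K : ℝ, 0 ≤ K ∧ ∀ S T, L (e f (S ∩ T)) ≤ K * (l S + l T) := by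
    intro f
    have hf : f ∈ Subgroup.closure (commutatorSet F) := by
      rw [← commutator_eq_closure, hF]; trivial
    induction hf using Subgroup.closure_induction with
    | mem x hx =>
      obtain ⟨g, h, rfl⟩ := hx
      refine ⟨2, by norm_num, fun S T => ?_⟩
      have : e ⁅g, h⁆ (S ∩ T) = e g S * e h T * (e g S)⁻¹ * (e h T)⁻¹ :=
        (mulIndicator_commutator g h S T).symm
      rw [this]
      have a1 := hm (e g S * e h T * (e g S)⁻¹) (e h T)⁻¹
      have a2 := hm (e g S * e h T) (e g S)⁻¹
      have a3 := hm (e g S) (e h T)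
      rw [hi] at a1 a2
      linarith [hel g S, hel h T]
    | one =>
      refine ⟨0, le_rfl, fun S T => ?_⟩
      have : e 1 (S ∩ T) = 1 := mulIndicator_one _ _
      rw [this, h1, zero_mul]
    | mul x y _ _ hx hy =>
      obtain ⟨K, hK, hx⟩ := hx
      obtain ⟨K', hK', hy⟩ := hy
      refine ⟨K + K', by positivity, fun S T => ?_⟩
      have : e (x * y) (S ∩ T) = e x (S ∩ T) * e y (S ∩ T) := mulIndicator_mul _ _ _
      rw [this]
      linarith [hm (e x (S ∩ T)) (e y (S ∩ T)), hx S T, hy S T]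
    | inv x _ hx =>
      obtain ⟨K, hK, hx⟩ := hx
      refine ⟨K, hK, fun S T => ?_⟩
      have : e x⁻¹ (S ∩ T) = (e x (S ∩ T))⁻¹ := mulIndicator_inv _ _
      rw [this, hi]
      exact hx S T
  choose K hK hKl using hcomm
  obtain ⟨B, hB⟩ := bounded_of_boolean_size l hl0 (K := ∑ f, K f)
    (Finset.sum_nonneg fun f _ => hK f)
    (fun S T => by
      rw [Finset.sum_mul]
      exact Finset.sum_le_sum fun f _ => hKl f S T)
    (fun A S hSA => by
      rw [← Finset.sum_add_distrib]
      refine Finset.sum_le_sum fun g _ => ?_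
      have : e g (A \ S) = e g A * (e g S)⁻¹ := mulIndicator_sdiff hSA _
      rw [this, ← hi (e g S)]
      exact hm _ _)
    (fun S T => by
      rw [← Finset.sum_add_distrib]
      refine Finset.sum_le_sum fun g _ => ?_
      have : e g S = e g (S ∩ T) * e g (S \ T) := by
        ext i
        by_cases hS : i ∈ S <;> by_cases hT : i ∈ T <;> simp [e, hS, hT]
      rw [this]
      exact hm _ _)
  refine ⟨∑ _g : F, B, fun y => ?_⟩
  -- The element `y` is the product, over the finitely many values `a`, of the constants `a` on its
  -- level sets.
  have hy : ∀ s : Finset F, L ((y ⁻¹' s).mulIndicator y) ≤ ∑ _g ∈ s, B := by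
    intro s
    induction s using Finset.induction_on with
    | empty =>
      rw [Finset.coe_empty, preimage_empty, mulIndicator_empty', h1, Finset.sum_empty]
    | insert a s ha ih =>
      rw [Finset.sum_insert ha]
      have : (y ⁻¹' ↑(insert a s)).mulIndicator y =
          e a (y ⁻¹' {a}) * (y ⁻¹' s).mulIndicator y := by
        ext i
        by_cases h : y i = a
        · simp [e, h, ha]
        · simp [e, mulIndicator_apply, h]
      rw [this]
      linarith [hm (e a (y ⁻¹' {a})) ((y ⁻¹' s).mulIndicator y), hel a (y ⁻¹' {a}),
        hB (y ⁻¹' {a})]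
  simpa using hy Finset.univ

end Powers

open scoped commutatorElement in
theorem commutator_alternatingGroup_five : commutator (alternatingGroup (Fin 5)) = ⊤ := by
  have : IsSimpleGroup (alternatingGroup (Fin 5)) := alternatingGroup.isSimpleGroup (by simp)
  refine (IsSimpleGroup.eq_bot_or_eq_top_of_normal _ inferInstance).resolve_left fun h => ?_
  have hcomm : ∀ a b : alternatingGroup (Fin 5), a * b = b * a := by
    intro a b
    have : ⁅a, b⁆ ∈ commutator (alternatingGroup (Fin 5)) :=
      Subgroup.commutator_mem_commutator (Subgroup.mem_top a) (Subgroup.mem_top b)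
    rw [h, Subgroup.mem_bot, commutatorElement_eq_one_iff_mul_comm] at this
    exact this
  have := congrArg Subtype.val (hcomm
    ⟨c[0, 1, 2], Equiv.Perm.mem_alternatingGroup.2 (by decide)⟩
    ⟨c[0, 1, 3], Equiv.Perm.mem_alternatingGroup.2 (by decide)⟩)
  revert this
  decide

/-- There is an infinite locally finite group with only bounded length functions. -/
theorem exists_lengthBounded_locallyFinite :
    ∃ (H : Type u) (_ : Group H), Infinite H ∧ LengthBounded H ∧ LocallyFiniteGroup H := by
  have : Nontrivial (alternatingGroup (Fin 5)) := by
    have := alternatingGroup.isSimpleGroup (α := Fin 5) (by simp)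
    infer_instance
  refine ⟨ULift.{u} (ℕ → alternatingGroup (Fin 5)), inferInstance, inferInstance, ?_, ?_⟩
  · exact (lengthBounded_pi commutator_alternatingGroup_five).of_surjective
      (MulEquiv.ulift.symm : _ ≃* ULift.{u} (ℕ → alternatingGroup (Fin 5))).toMonoidHom
      MulEquiv.ulift.symm.surjective
  · exact (locallyFiniteGroup_pi ℕ (alternatingGroup (Fin 5))).of_injective
      (MulEquiv.ulift : ULift.{u} (ℕ → alternatingGroup (Fin 5)) ≃* _).toMonoidHom
      MulEquiv.ulift.injective

/-! ### Fixed-point-free actions of countable locally finite groups. -/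

/-- A length function with natural values that satisfies the ultrametric inequality. -/
structure UltrametricLength (K : Type*) [Group K] where
  len : K → ℕ
  len_one : len 1 = 0
  len_inv : ∀ g, len g⁻¹ = len g
  len_mul_le : ∀ g h, len (g * h) ≤ max (len g) (len h)

/-- The length of `g` is the first stage containing `g` in an exhaustion by finite subgroups;
closure of the stages under products is the ultrametric inequality. -/
theorem LocallyFiniteGroup.exists_proper_ultrametricLength {K : Type*} [Group K] [Countable K]
    (hK : LocallyFiniteGroup K) :
    ∃ N : UltrametricLength K, ∀ n, {g | N.len g ≤ n}.Finite := by
  classical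
  obtain ⟨f, hf⟩ := exists_surjective_nat K
  let C : ℕ → Subgroup K := fun n => Subgroup.closure (f '' Iio n)
  have hC : Monotone C := fun m n hmn =>
    Subgroup.closure_mono (image_mono (Iio_subset_Iio hmn))
  have hex : ∀ g, ∃ n, g ∈ C n := fun g => by
    obtain ⟨n, rfl⟩ := hf g
    exact ⟨n + 1, Subgroup.subset_closure ⟨n, by simp, rfl⟩⟩
  have hle : ∀ g n, Nat.find (hex g) ≤ n ↔ g ∈ C n := fun g n =>
    ⟨fun h => hC h (Nat.find_spec (hex g)), fun h => Nat.find_min' _ h⟩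
  refine ⟨⟨fun g => Nat.find (hex g), ?_, ?_, ?_⟩, fun n => ?_⟩
  · exact Nat.le_zero.1 ((hle _ _).2 (one_mem _))
  · intro g
    exact eq_of_forall_ge_iff fun n => by rw [hle, hle, inv_mem_iff]
  · intro g h
    rw [hle]
    exact mul_mem ((hle _ _).1 (le_max_left _ _)) ((hle _ _).1 (le_max_right _ _))
  · simp only [hle]
    exact hK _ ((finite_Iio n).image f)

section LpReindex

/-- Permuting coordinates is an isometry of the sequence space `ℓ²`. -/
noncomputable def lpReindex {I : Type*} (e : I ≃ I) :
    lp (fun _ : I => ℝ) 2 ≃ₗᵢ[ℝ] lp (fun _ : I => ℝ) 2 where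
  toFun v := ⟨fun i => v (e i), by
    have h := (memℓp_gen_iff (by norm_num)).1 (lp.memℓp v)
    exact (memℓp_gen_iff (by norm_num)).2 (e.summable_iff.2 h)⟩
  invFun v := ⟨fun i => v (e.symm i), by
    have h := (memℓp_gen_iff (by norm_num)).1 (lp.memℓp v)
    exact (memℓp_gen_iff (by norm_num)).2 (e.symm.summable_iff.2 h)⟩
  map_add' _ _ := rfl
  map_smul' _ _ := rfl
  left_inv v := by ext i; simp
  right_inv v := by ext i; simp
  norm_map' v := by
    have h2 : (0 : ℝ) < (2 : ℝ≥0∞).toReal := by norm_num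
    rw [lp.norm_eq_tsum_rpow h2, lp.norm_eq_tsum_rpow h2]
    congr 1
    exact e.tsum_eq fun i => ‖v i‖ ^ (2 : ℝ≥0∞).toReal

/-- Coordinates of an `ℓ²` vector tend to zero; this will exclude fixed vectors. -/
theorem lp_finite_eq {I : Type*} (v : lp (fun _ : I => ℝ) 2) {c : ℝ} (hc : c ≠ 0) :
    {i | v i = c}.Finite := by
  have h := (memℓp_gen_iff (by norm_num)).1 (lp.memℓp v)
  have h1 := h.tendsto_cofinite_zero.eventually_ne
    (b₂ := ‖c‖ ^ (2 : ℝ≥0∞).toReal) (by simpa using (pow_ne_zero 2 hc).symm)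
  refine (Filter.eventually_cofinite.1 h1).subset fun i hi => ?_
  simp only [mem_ofPred_eq] at hi ⊢
  simp [hi]

end LpReindex

section FixedPointFree

variable {K : Type u} [Group K]

theorem UltrametricLength.len_mul_le_iff (N : UltrametricLength K) {g : K} {n : ℕ}
    (hg : N.len g ≤ n) (h : K) : N.len (g * h) ≤ n ↔ N.len h ≤ n := by
  constructor
  · intro h1
    have := N.len_mul_le g⁻¹ (g * h)
    rw [inv_mul_cancel_left, N.len_inv] at this
    exact this.trans (max_le hg h1)
  · exact fun h1 => (N.len_mul_le g h).trans (max_le hg h1)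

/-- The indicator of the ball of radius `i.1` in `K`. -/
noncomputable def UltrametricLength.ball (N : UltrametricLength K) (i : ℕ × K) : ℝ :=
  if N.len i.2 ≤ i.1 then 1 else 0

/-- The support is finite: balls of radius at least `N.len g` are subgroups containing `g`, hence
unchanged by translation, and for the smaller radii the difference lives in the finite ball of
radius `N.len g`. -/
theorem UltrametricLength.ball_sub_memℓp (N : UltrametricLength K)
    (hN : ∀ n, {g | N.len g ≤ n}.Finite) (g : K) :
    Memℓp (fun i : ℕ × K => N.ball (i.1, g⁻¹ * i.2) - N.ball i) 2 := by
  refine (memℓp_gen_iff (by norm_num)).2 (summable_of_hasFiniteSupport ?_)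
  refine ((finite_Iio (N.len g)).prod (hN (N.len g))).subset ?_
  rintro ⟨n, h⟩ hi
  by_contra hcon
  refine hi ?_
  have : N.ball (n, g⁻¹ * h) = N.ball (n, h) := by
    by_cases hn : N.len g ≤ n
    · exact if_congr (N.len_mul_le_iff (by rwa [N.len_inv]) h) rfl rfl
    · have hh : ¬ N.len h ≤ N.len g := fun hh => hcon ⟨not_le.1 hn, hh⟩
      have h1 : ¬ N.len h ≤ n := by omega
      have h2 : ¬ N.len (g⁻¹ * h) ≤ n := fun h2 => hh
        ((N.len_mul_le_iff (N.len_inv g).le h).1 (by omega))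
      exact (if_neg h2).trans (if_neg h1).symm
  simp [this]

/-- An infinite discrete group with a proper ultrametric length acts by affine isometries on a
Hilbert space without fixed points. -/
theorem UltrametricLength.not_propertyFH [TopologicalSpace K] [DiscreteTopology K] [Infinite K]
    (N : UltrametricLength K) (hN : ∀ n, {g | N.len g ≤ n}.Finite) : ¬ PropertyFH K := by
  intro hFH
  let e : K → (ℕ × K ≃ ℕ × K) := fun g => (Equiv.refl ℕ).prodCongr (Equiv.mulLeft g⁻¹)
  -- The cocycle is the formal coboundary of `N.ball`, which is not itself in `ℓ²`.
  let b : K → lp (fun _ : ℕ × K => ℝ) 2 := fun g => ⟨_, N.ball_sub_memℓp hN g⟩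
  let A : K → (lp (fun _ : ℕ × K => ℝ) 2 ≃ᵃⁱ[ℝ] lp (fun _ : ℕ × K => ℝ) 2) := fun g =>
    (lpReindex (e g)).toAffineIsometryEquiv.trans (AffineIsometryEquiv.constVAdd ℝ _ (b g))
  have hA : ∀ g v i, A g v i = N.ball (i.1, g⁻¹ * i.2) - N.ball i + v (i.1, g⁻¹ * i.2) :=
    fun g v i => rfl
  let α : K →* (lp (fun _ : ℕ × K => ℝ) 2 ≃ᵃⁱ[ℝ] lp (fun _ : ℕ × K => ℝ) 2) :=
    { toFun := A
      map_one' := by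
        ext v i
        rw [hA]
        simp
      map_mul' := fun g h => by
        ext v i
        change A (g * h) v i = A g (A h v) i
        rw [hA, hA, hA]
        simp only [mul_inv_rev, mul_assoc]
        ring }
  obtain ⟨v, hv⟩ := hFH _ α
    (continuous_prod_of_discrete_left.2 fun g => (α g).continuous)
  -- For a fixed vector `v`, the sum `v + N.ball` is translation invariant, so constant on each
  -- level. The constant is zero because `v` takes it on the infinite complement of a ball; hence `v
  -- (n, 1) = -1` for all `n`.
  have hconst : ∀ n h, v (n, h) + N.ball (n, h) = v (n, 1) + 1 := by
    intro n h
    have := congrArg (fun w : lp (fun _ : ℕ × K => ℝ) 2 => w (n, h)) (hv h)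
    change A h v (n, h) = v (n, h) at this
    rw [hA] at this
    simp only [inv_mul_cancel] at this
    have h1 : N.ball (n, (1 : K)) = 1 := by simp [UltrametricLength.ball, N.len_one]
    linarith
  have hzero : ∀ n, v (n, 1) + 1 = 0 := by
    intro n
    by_contra hc
    have hinf : {g | N.len g ≤ n}ᶜ.Infinite := (hN n).infinite_compl
    refine (hinf.image (f := fun h => (n, h)) (fun _ _ _ _ h => (Prod.ext_iff.1 h).2))
      ((lp_finite_eq v hc).subset ?_)
    rintro _ ⟨h, hh, rfl⟩
    have h0 : N.ball (n, h) = 0 := if_neg hh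
    have := hconst n h
    rw [h0, add_zero] at this
    exact this
  refine (infinite_range_of_injective (f := fun n : ℕ => (n, (1 : K)))
    (fun _ _ h => (Prod.ext_iff.1 h).1)) ((lp_finite_eq v (c := -1) (by norm_num)).subset ?_)
  rintro _ ⟨n, rfl⟩
  change v (n, 1) = -1
  linarith [hzero n]

/-- The points `(g, s)` representing the tree of an ultrametric length: the point at height `s`
above `g`, where the rays above `g` and `h` merge at height `N.len (g⁻¹ * h)`. -/
@[ext]
structure UltrametricLength.Horo (N : UltrametricLength K) : Type u where
  pt : K
  height : NNReal

namespace UltrametricLength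

variable (N : UltrametricLength K)

/-- The height at which the upward rays from two points merge. -/
noncomputable def meet (p q : N.Horo) : ℝ :=
  max (max (p.height : ℝ) q.height) (N.len (p.pt⁻¹ * q.pt))

theorem meet_comm (p q : N.Horo) : N.meet p q = N.meet q p := by
  unfold meet
  rw [max_comm (p.height : ℝ), ← N.len_inv (p.pt⁻¹ * q.pt), mul_inv_rev, inv_inv]

theorem left_le_meet (p q : N.Horo) : (p.height : ℝ) ≤ N.meet p q :=
  (le_max_left _ _).trans (le_max_left _ _)

theorem right_le_meet (p q : N.Horo) : (q.height : ℝ) ≤ N.meet p q :=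
  (le_max_right _ _).trans (le_max_left _ _)

theorem meet_le (p q r : N.Horo) : N.meet p r ≤ max (N.meet p q) (N.meet q r) := by
  refine max_le (max_le ?_ ?_) ?_
  · exact (N.left_le_meet p q).trans (le_max_left _ _)
  · exact (N.right_le_meet q r).trans (le_max_right _ _)
  · have h := N.len_mul_le (p.pt⁻¹ * q.pt) (q.pt⁻¹ * r.pt)
    rw [mul_assoc, mul_inv_cancel_left] at h
    refine (Nat.cast_le.2 h).trans ?_
    rw [Nat.cast_max]
    exact max_le_max (le_max_right _ _) (le_max_right _ _)

theorem meet_self (p : N.Horo) : N.meet p p = p.height := by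
  simp [meet, N.len_one]

/-- The distance climbs from `p` to the merging height and descends to `q`. Points on merged rays at
equal height are at distance zero. -/
noncomputable instance : PseudoMetricSpace N.Horo where
  dist p q := 2 * N.meet p q - p.height - q.height
  dist_self p := by rw [meet_self]; ring
  dist_comm p q := by rw [meet_comm]; ring
  dist_triangle p q r := by
    have a := N.right_le_meet p q
    have b := N.left_le_meet q r
    rcases le_max_iff.1 (N.meet_le p q r) with h | h <;> linarith

theorem horo_dist (p q : N.Horo) : dist p q = 2 * N.meet p q - p.height - q.height := rfl

instance : SMul K N.Horo := ⟨fun k p => ⟨k * p.pt, p.height⟩⟩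

instance : MulAction K N.Horo where
  one_smul _ := UltrametricLength.Horo.ext (one_mul _) rfl
  mul_smul _ _ _ := UltrametricLength.Horo.ext (mul_assoc _ _ _) rfl

theorem smul_def (k : K) (p : N.Horo) : k • p = ⟨k * p.pt, p.height⟩ := rfl

instance : IsIsometricSMul K N.Horo := ⟨fun k => Isometry.of_dist_eq fun p q => by
  have : N.meet (k • p) (k • q) = N.meet p q := by
    simp only [meet, smul_def, mul_inv_rev, mul_assoc, inv_mul_cancel_left]
  rw [horo_dist, this]
  rfl⟩

/-- The tree of an ultrametric length. -/
abbrev Tree : Type u := SeparationQuotient N.Horo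

instance : IsIsometricSMul K N.Tree := ⟨fun k => Isometry.of_dist_eq fun p q => by
  obtain ⟨p, rfl⟩ := SeparationQuotient.surjective_mk p
  obtain ⟨q, rfl⟩ := SeparationQuotient.surjective_mk q
  rw [← SeparationQuotient.mk_smul, ← SeparationQuotient.mk_smul, SeparationQuotient.dist_mk,
    SeparationQuotient.dist_mk, dist_smul]⟩

/-- The heights cancel, and what remains is the four-point condition for the ultrametric `meet`. -/
theorem fourPoint_tree : FourPoint N.Tree := by
  intro x y z w
  obtain ⟨x, rfl⟩ := SeparationQuotient.surjective_mk x
  obtain ⟨y, rfl⟩ := SeparationQuotient.surjective_mk y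
  obtain ⟨z, rfl⟩ := SeparationQuotient.surjective_mk z
  obtain ⟨w, rfl⟩ := SeparationQuotient.surjective_mk w
  simp only [SeparationQuotient.dist_mk, horo_dist]
  by_contra hcon
  rw [not_le, max_lt_iff] at hcon
  obtain ⟨h1, h2⟩ := hcon
  have c1 := N.meet_comm y z
  have c2 := N.meet_comm y w
  rcases le_max_iff.1 (N.meet_le x z y) with a | a <;>
  rcases le_max_iff.1 (N.meet_le x w y) with b | b <;>
  rcases le_max_iff.1 (N.meet_le z x w) with c | c <;>
  rcases le_max_iff.1 (N.meet_le z y w) with d | d <;>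
  linarith [N.meet_comm z x, N.meet_comm z y, N.meet_comm w y, N.meet_comm w x]

theorem isRealTree_tree : IsRealTree N.Tree := by
  have : Nonempty N.Horo := ⟨⟨1, 0⟩⟩
  refine isRealTree_of_fourPoint N.fourPoint_tree fun x y t h0 h1 => ?_
  obtain ⟨x, rfl⟩ := SeparationQuotient.surjective_mk x
  obtain ⟨y, rfl⟩ := SeparationQuotient.surjective_mk y
  obtain ⟨g, s⟩ := x
  obtain ⟨h, r⟩ := y
  rw [SeparationQuotient.dist_mk, horo_dist] at h1 ⊢
  set M := N.meet ⟨g, s⟩ ⟨h, r⟩ with hM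
  have hs : (s : ℝ) ≤ M := N.left_le_meet ⟨g, s⟩ ⟨h, r⟩
  have hr : (r : ℝ) ≤ M := N.right_le_meet ⟨g, s⟩ ⟨h, r⟩
  have hl : (N.len (g⁻¹ * h) : ℝ) ≤ M := le_max_right _ _
  have hself : ∀ k : K, (N.len (k⁻¹ * k) : ℝ) = 0 := fun k => by simp [N.len_one]
  have hMc : M = max (max (s : ℝ) r) (N.len (g⁻¹ * h)) := rfl
  simp only at h1 ⊢
  -- The geodesic climbs above `g` up to height `M`, then descends above `h`.
  rcases le_total t (M - s) with ht | ht
  · obtain ⟨a, ha⟩ : ∃ a : NNReal, (a : ℝ) = s + t := ⟨⟨s + t, add_nonneg s.2 h0⟩, rfl⟩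
    refine ⟨SeparationQuotient.mk ⟨g, a⟩, ?_, ?_⟩
    · rw [SeparationQuotient.dist_mk, horo_dist]
      simp only [meet, hself]
      rw [max_eq_right (by linarith : (s : ℝ) ≤ a), max_eq_left a.coe_nonneg, ha]
      ring
    · rw [SeparationQuotient.dist_mk, horo_dist]
      have : N.meet ⟨g, a⟩ ⟨h, r⟩ = M := by
        refine le_antisymm (max_le (max_le (by linarith) hr) hl) ?_
        rw [hMc]
        exact max_le_max (max_le_max (by linarith) le_rfl) le_rfl
      rw [this]
      linarith
  · obtain ⟨a, ha⟩ : ∃ a : NNReal, (a : ℝ) = 2 * M - s - t :=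
      ⟨⟨2 * M - s - t, by linarith [NNReal.coe_nonneg r]⟩, rfl⟩
    refine ⟨SeparationQuotient.mk ⟨h, a⟩, ?_, ?_⟩
    · rw [SeparationQuotient.dist_mk, horo_dist]
      have : N.meet ⟨g, s⟩ ⟨h, a⟩ = M := by
        refine le_antisymm (max_le (max_le hs (by linarith)) hl) ?_
        rw [hMc]
        exact max_le_max (max_le_max le_rfl (by linarith)) le_rfl
      rw [this]
      linarith
    · rw [SeparationQuotient.dist_mk, horo_dist]
      simp only [meet, hself]
      rw [max_eq_left (by linarith : (r : ℝ) ≤ a), max_eq_left a.coe_nonneg, ha]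
      ring

/-- A discrete group with an unbounded ultrametric length acts on a real tree without fixed
points. -/
theorem not_propertyFR [TopologicalSpace K] [DiscreteTopology K]
    (hN : ∀ n : ℕ, ∃ g, n < N.len g) : ¬ PropertyFR K := by
  intro hFR
  have : ContinuousSMul K N.Tree := ⟨continuous_prod_of_discrete_left.2 continuous_const_smul⟩
  obtain ⟨x, hx⟩ := hFR N.Tree N.isRealTree_tree
  obtain ⟨x, rfl⟩ := SeparationQuotient.surjective_mk x
  obtain ⟨g, s⟩ := x
  obtain ⟨n, hn⟩ := exists_nat_ge (s : ℝ)
  obtain ⟨k, hk⟩ := hN n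
  -- Conjugating by `g` makes the ray above `g` merge with its image only at height `N.len k > s`.
  have h := hx (g * k * g⁻¹)
  rw [← SeparationQuotient.mk_smul, ← dist_eq_zero, SeparationQuotient.dist_mk, dist_comm,
    horo_dist] at h
  have hl : (N.len (g⁻¹ * (g * k * g⁻¹ * g)) : ℝ) ≤
      N.meet ⟨g, s⟩ ((g * k * g⁻¹) • (⟨g, s⟩ : N.Horo)) := le_max_right _ _
  rw [inv_mul_cancel_right, inv_mul_cancel_left] at hl
  have hk' : (n : ℝ) < N.len k := by exact_mod_cast hk
  simp only [smul_def] at h hl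
  linarith

end UltrametricLength

end FixedPointFree

/-! ### Bounded lengths imply the three properties. -/

theorem LengthBounded.propertyOB {G : Type u} [Group G] [TopologicalSpace G]
    (hG : LengthBounded G) : PropertyOB G := by
  intro X _ _ _ _ x
  exact (isBounded_orbit_iff x).2 (hG.isBounded_orbit x)

theorem LengthBounded.propertyFR {G : Type u} [Group G] [TopologicalSpace G]
    (hG : LengthBounded G) : PropertyFR G := by
  intro X _ _ _ _ hX
  exact hG.exists_fixed_realTree hX

/-- Bounded orbits force fixed points on Hilbert spaces. -/
theorem PropertyOB.propertyFH {G : Type u} [Group G] [TopologicalSpace G]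
    (hG : PropertyOB G) : PropertyFH G := by
  intro E _ _ _ α hα
  let _ : MulAction G E :=
    { smul := fun g x => α g x
      one_smul := fun x => by change α 1 x = x; rw [map_one]; rfl
      mul_smul := fun g h x => by change α (g * h) x = α g (α h x); rw [map_mul]; rfl }
  have : IsIsometricSMul G E := ⟨fun g => (α g).isometry⟩
  have : ContinuousSMul G E := ⟨hα⟩
  exact exists_fixed_of_bounded α 0 ((isBounded_orbit_iff (0 : E)).1 (hG E 0))

/-! ### Countable witnesses of failure. -/

namespace TopGroupProperty

/-- Failure of the property is witnessed by countably many elements. -/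
def CountablyWitnessed (P : TopGroupProperty.{u}) : Prop :=
  ∀ (G : Type u) [Group G] [TopologicalSpace G], ¬ P G → ∃ h : ℕ → G,
    ∀ (K : Type u) [Group K] [TopologicalSpace K] (φ : K →* G), Continuous φ →
      (∀ n, h n ∈ φ.range) → ¬ P K

end TopGroupProperty

section Pullback

variable {G K X : Type*} [Group G] [Group K] [MetricSpace X] [MulAction G X] [IsIsometricSMul G X]

theorem isIsometricSMul_compHom (φ : K →* G) :
    letI : MulAction K X := MulAction.compHom X φ
    IsIsometricSMul K X := by
  let _ : MulAction K X := MulAction.compHom X φ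
  exact ⟨fun k => isometry_smul X (φ k)⟩

end Pullback

theorem countablyWitnessed_OB : PropertyOB.{u}.CountablyWitnessed := by
  intro G _ _ hG
  unfold PropertyOB at hG
  push Not at hG
  obtain ⟨X, _, _, _, _, x, hx⟩ := hG
  rw [isBounded_orbit_iff] at hx
  push Not at hx
  choose h hh using fun n : ℕ => hx n
  refine ⟨h, fun K _ _ φ hφ hr hK => ?_⟩
  let _ : MulAction K X := MulAction.compHom X φ
  have : IsIsometricSMul K X := isIsometricSMul_compHom φ
  have : ContinuousSMul K X := MulAction.continuousSMul_compHom hφ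
  obtain ⟨B, hB⟩ := (isBounded_orbit_iff x).1 (hK X x)
  obtain ⟨n, hn⟩ := exists_nat_ge B
  obtain ⟨k, hk⟩ := hr n
  have h1 : dist x (φ k • x) ≤ B := hB k
  rw [hk] at h1
  linarith [hh n]

/-- Without a fixed point the orbit of `0` is unbounded, whereas a fixed point `y` would bound
displacements of `0` by `2 * dist 0 y`. -/
theorem countablyWitnessed_FH : PropertyFH.{u}.CountablyWitnessed := by
  intro G _ _ hG
  unfold PropertyFH at hG
  push Not at hG
  obtain ⟨E, _, _, _, α, hα, hno⟩ := hG
  have hx : ∀ n : ℕ, ∃ g, (n : ℝ) < dist 0 (α g 0) := by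
    by_contra hcon
    push Not at hcon
    obtain ⟨n, hn⟩ := hcon
    obtain ⟨y, hy⟩ := exists_fixed_of_bounded α 0 ⟨n, hn⟩
    obtain ⟨g, hg⟩ := hno y
    exact hg (hy g)
  choose h hh using hx
  refine ⟨h, fun K _ _ φ hφ hr hK => ?_⟩
  obtain ⟨y, hy⟩ := hK E (α.comp φ) (hα.comp (hφ.prodMap continuous_id))
  obtain ⟨n, hn⟩ := exists_nat_ge (2 * dist 0 y)
  obtain ⟨k, hk⟩ := hr n
  have h1 : α (h n) y = y := by rw [← hk]; exact hy k
  have h2 : dist y (α (h n) 0) = dist 0 y := by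
    conv_lhs => rw [← h1]
    rw [(α (h n)).dist_map, dist_comm]
  linarith [hh n, dist_triangle 0 y (α (h n) 0)]

theorem countablyWitnessed_FR : PropertyFR.{u}.CountablyWitnessed := by
  intro G _ _ hG
  unfold PropertyFR at hG
  push Not at hG
  obtain ⟨X, _, _, _, _, hX, hno⟩ := hG
  obtain ⟨x⟩ := hX.nonempty
  by_cases hb : ∃ B, ∀ g : G, dist x (g • x) ≤ B
  · have hbdd : BddAbove (range fun g : G => dist x (g • x)) := by
      obtain ⟨B, hB⟩ := hb
      exact ⟨B, by rintro _ ⟨g, rfl⟩; exact hB g⟩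
    set D := ⨆ g : G, dist x (g • x) with hD
    -- The tree may be incomplete, so bounded orbits do not exclude a fixed-point-free action; the
    -- witnesses approximate the supremum of the displacements.
    have hs : ∀ n : ℕ, ∃ g : G, D - 1 / (n + 1) < dist x (g • x) := fun n =>
      exists_lt_of_lt_ciSup (sub_lt_self _ Nat.one_div_pos_of_nat)
    choose h hh using hs
    refine ⟨h, fun K _ _ φ hφ hr hK => ?_⟩
    let _ : MulAction K X := MulAction.compHom X φ
    have : IsIsometricSMul K X := isIsometricSMul_compHom φ
    have : ContinuousSMul K X := MulAction.continuousSMul_compHom hφ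
    obtain ⟨p, hp⟩ := hK X hX
    obtain ⟨q, hq⟩ := hX.exists_fixed_of_approx (G := G) (fun g => le_ciSup hbdd g)
      (p := p) (fun ε hε => by
        obtain ⟨n, hn⟩ := exists_nat_one_div_lt hε
        obtain ⟨k, hk⟩ := hr n
        exact ⟨h n, by linarith [hh n], by rw [← hk]; exact hp k⟩)
    obtain ⟨g, hg⟩ := hno q
    exact hg (hq g)
  · push Not at hb
    choose h hh using fun n : ℕ => hb n
    refine ⟨h, fun K _ _ φ hφ hr hK => ?_⟩
    let _ : MulAction K X := MulAction.compHom X φ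
    have : IsIsometricSMul K X := isIsometricSMul_compHom φ
    have : ContinuousSMul K X := MulAction.continuousSMul_compHom hφ
    obtain ⟨y, hy⟩ := hK X hX
    obtain ⟨n, hn⟩ := exists_nat_ge (2 * dist x y)
    obtain ⟨k, hk⟩ := hr n
    have h1 : h n • y = y := by rw [← hk]; exact hy k
    have h2 : dist y (h n • x) = dist x y := by
      conv_lhs => rw [← h1]
      rw [dist_smul, dist_comm]
    linarith [hh n, dist_triangle x y (h n • x)]

/-! ### Cardinalities and density characters. -/

section Cardinality

theorem mk_subgroup_closure_le {G : Type u} [Group G] (S : Set G) :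
    #(Subgroup.closure S) ≤ max #S ℵ₀ := by
  have hr : (FreeGroup.lift ((↑) : S → G)).range = Subgroup.closure S := by
    rw [FreeGroup.range_lift_eq_closure, Subtype.range_coe]
  rw [← hr]
  refine (mk_le_of_surjective (FreeGroup.lift ((↑) : S → G)).rangeRestrict_surjective).trans ?_
  rcases isEmpty_or_nonempty S with h | h
  · exact (le_aleph0_iff_set_countable.2 (to_countable (univ : Set (FreeGroup S)))
      |> (mk_univ (α := FreeGroup S)).symm.le.trans).trans (le_max_right _ _)
  · exact (mk_freeGroup S).le

theorem densityCharacter_le {X : Type u} [TopologicalSpace X] {s : Set X} (hs : Dense s) :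
    densityCharacter X ≤ #s :=
  csInf_le' ⟨s, hs, rfl⟩

theorem exists_dense_mk_eq (X : Type u) [TopologicalSpace X] :
    ∃ s : Set X, Dense s ∧ #s = densityCharacter X :=
  csInf_mem (s := {κ | ∃ s : Set X, Dense s ∧ #s = κ}) ⟨_, univ, dense_univ, rfl⟩

theorem densityCharacter_of_discrete (X : Type u) [TopologicalSpace X] [DiscreteTopology X] :
    densityCharacter X = #X := by
  obtain ⟨s, hs, h⟩ := exists_dense_mk_eq X
  rw [← h, dense_discrete.1 hs, mk_univ]

theorem infinite_of_dense {X : Type u} [TopologicalSpace X] [T1Space X] [Infinite X] {s : Set X}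
    (hs : Dense s) : s.Infinite := by
  intro hf
  have := hs.closure_eq
  rw [hf.isClosed.closure_eq] at this
  exact infinite_univ (this ▸ hf)

theorem aleph0_le_densityCharacter (X : Type u) [TopologicalSpace X] [T1Space X] [Infinite X] :
    ℵ₀ ≤ densityCharacter X := by
  obtain ⟨s, hs, h⟩ := exists_dense_mk_eq X
  rw [← h]
  have := (infinite_of_dense hs).to_subtype
  exact aleph0_le_mk s

/-- The density character of metric spaces is monotone. -/
theorem densityCharacter_mono {X : Type u} [MetricSpace X] {s t : Set X} (hst : s ⊆ t)
    (hs : s.Infinite) : densityCharacter s ≤ densityCharacter t := by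
  classical
  have : Infinite t := (hs.mono hst).to_subtype
  have hsinf := hs.to_subtype
  obtain ⟨c₀⟩ : Nonempty s := inferInstance
  obtain ⟨T, hT, hTc⟩ := exists_dense_mk_eq t
  have hTinf := (infinite_of_dense hT).to_subtype
  -- For each point of `T` and each radius a nearby point of `s` is chosen if there is one; `c₀` is
  -- only a default value.
  have hf : ∀ p : T × ℕ, ∃ c : s, (∃ c' : s, dist (c' : X) p.1.1 < 1 / (p.2 + 1)) →
      dist (c : X) p.1.1 < 1 / (p.2 + 1) := by
    intro p
    by_cases h : ∃ c' : s, dist (c' : X) p.1.1 < 1 / (p.2 + 1)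
    · exact h.imp fun c hc _ => hc
    · exact ⟨c₀, fun h' => absurd h' h⟩
  choose f hf using hf
  have hd : Dense (range f) := by
    rw [Metric.dense_iff]
    intro c r hr
    obtain ⟨n, hn⟩ := exists_nat_one_div_lt (half_pos hr)
    obtain ⟨y, hy, hyT⟩ := Metric.dense_iff.1 hT ⟨c, hst c.2⟩ (1 / (n + 1))
      Nat.one_div_pos_of_nat
    rw [Metric.mem_ball, Subtype.dist_eq] at hy
    have h1 := hf (⟨y, hyT⟩, n) ⟨c, by rw [dist_comm]; exact hy⟩
    refine ⟨f (⟨y, hyT⟩, n), ?_, mem_range_self _⟩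
    rw [Metric.mem_ball, Subtype.dist_eq]
    simp only at h1 hy hn
    linarith [dist_triangle (f (⟨y, hyT⟩, n) : X) y c]
  calc densityCharacter s ≤ #(range f) := densityCharacter_le hd
    _ ≤ #(T × ℕ) := mk_range_le
    _ = #T := by simp
    _ = densityCharacter t := hTc

end Cardinality

/-! ### Metric groups and bountifulness. -/

section MetricGroup

variable {D : ℝ≥0∞} {H : Type u} [Group H] [MetricSpace H]

/-- Bi-invariance makes multiplication 2-Lipschitz and inversion isometric; it is needed for
closures of subgroups to be subgroups. -/
theorem IsContinuousMetricGroup.isTopologicalGroup (hH : IsContinuousMetricGroup D H) :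
    IsTopologicalGroup H where
  continuous_mul := by
    refine LipschitzWith.continuous (K := 2) (LipschitzWith.of_dist_le_mul fun p q => ?_)
    have h1 : dist (p.1 * p.2) (q.1 * p.2) = dist p.1 q.1 := hH.dist_mul_right _ _ _
    have h2 : dist (q.1 * p.2) (q.1 * q.2) = dist p.2 q.2 := hH.dist_mul_left _ _ _
    have h3 : dist p.1 q.1 ≤ dist p q := le_max_left _ _
    have h4 : dist p.2 q.2 ≤ dist p q := le_max_right _ _
    have h5 : ((2 : NNReal) : ℝ) = 2 := rfl
    rw [h5]
    linarith [dist_triangle (p.1 * p.2) (q.1 * p.2) (q.1 * q.2)]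
  continuous_inv := by
    refine (Isometry.of_dist_eq fun x y => ?_).continuous
    rw [← hH.dist_mul_left x, ← hH.dist_mul_right y]
    simp [dist_comm]

theorem IsContinuousMetricGroup.subgroup (hH : IsContinuousMetricGroup D H) {K : Subgroup H}
    (hK : IsClosed (K : Set H)) : IsContinuousMetricGroup D K where
  complete := by
    have := hH.complete
    exact hK.completeSpace_coe
  dist_mul_left a x y := hH.dist_mul_left a x y
  dist_mul_right a x y := hH.dist_mul_right a x y
  edist_le x y := hH.edist_le x y

end MetricGroup

namespace TopGroupProperty

theorem CountablyWitnessed.bountifulDiscrete {P : TopGroupProperty.{u}}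
    (hP : P.CountablyWitnessed) : P.Non.BountifulDiscrete := by
  intro H _ hH G hG
  obtain ⟨h, hh⟩ := @hP H _ ⊥ hH
  have hle : G ≤ Subgroup.closure (G ∪ range h) :=
    fun g hg => Subgroup.subset_closure (Or.inl hg)
  refine ⟨Subgroup.closure (G ∪ range h), ?_, hle, le_antisymm (mk_le_mk_of_subset hle) ?_⟩
  · refine @hh _ _ ⊥ (Subgroup.subtype _) continuous_bot fun n => ?_
    rw [Subgroup.range_subtype]
    exact Subgroup.subset_closure (Or.inr ⟨n, rfl⟩)
  · have h0 : ℵ₀ ≤ #G := aleph0_le_mk G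
    refine (mk_subgroup_closure_le _).trans (max_le ((mk_union_le _ _).trans ?_) h0)
    exact add_le_of_le h0 le_rfl ((countable_range h).le_aleph0.trans h0)

/-- Generating from a dense subset of `C` keeps the cardinality down; taking the closure recovers
`C` and completeness. -/
theorem CountablyWitnessed.bountifulMetric {P : TopGroupProperty.{u}}
    (hP : P.CountablyWitnessed) (D : ℝ≥0∞) : P.Non.BountifulMetric D := by
  intro H _ _ _ hH hnP C hC
  have := hH.isTopologicalGroup
  obtain ⟨h, hh⟩ := hP H hnP
  have hCinf := hC.to_subtype
  obtain ⟨T, hT, hTc⟩ := exists_dense_mk_eq C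
  set S : Set H := (↑) '' T ∪ range h with hS
  set K : Subgroup H := (Subgroup.closure S).topologicalClosure with hK
  have hSK : S ⊆ K := Subgroup.subset_closure.trans (Subgroup.le_topologicalClosure _)
  have hKc : IsClosed (K : Set H) := Subgroup.isClosed_topologicalClosure _
  have hCK : C ⊆ K := by
    intro c hc
    have h1 : c ∈ closure (((↑) : C → H) '' T) :=
      image_closure_subset_closure_image continuous_subtype_val
        ⟨⟨c, hc⟩, hT.closure_eq ▸ mem_univ _, rfl⟩
    exact closure_minimal (subset_union_left.trans hSK) hKc h1
  refine ⟨K, hH.subgroup hKc, ?_, hCK, le_antisymm (densityCharacter_mono hCK hC) ?_⟩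
  · refine hh K K.subtype continuous_subtype_val fun n => ?_
    rw [Subgroup.range_subtype]
    exact hSK (Or.inr ⟨n, rfl⟩)
  · have h0 : ℵ₀ ≤ densityCharacter C := aleph0_le_densityCharacter C
    have hd : Dense (((↑) : K → H) ⁻¹' (Subgroup.closure S : Set H)) := by
      intro x
      have himg : ((↑) : K → H) '' (((↑) : K → H) ⁻¹' (Subgroup.closure S : Set H)) =
          Subgroup.closure S := image_preimage_eq_of_subset fun y hy =>
        ⟨⟨y, Subgroup.le_topologicalClosure _ hy⟩, rfl⟩
      rw [closure_subtype, himg]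
      exact x.2
    refine (densityCharacter_le hd).trans ?_
    refine (mk_preimage_of_injective _ _ Subtype.val_injective).trans ?_
    refine (mk_subgroup_closure_le _).trans (max_le ((mk_union_le _ _).trans ?_) h0)
    exact add_le_of_le h0 (mk_image_le.trans hTc.le) ((countable_range h).le_aleph0.trans h0)

/-- A property that all groups with only bounded length functions have, and that infinite countable
locally finite discrete groups lack. -/
structure Separating (P : TopGroupProperty.{u}) : Prop where
  of_lengthBounded : ∀ (G : Type u) [Group G] [TopologicalSpace G], LengthBounded G → P G
  not_of_locallyFinite : ∀ (K : Type u) [Group K] [TopologicalSpace K] [DiscreteTopology K],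
    Infinite K → Countable K → LocallyFiniteGroup K → ¬ P K

theorem exists_countable_subgroup (H : Type u) [Group H] [Infinite H] :
    ∃ G : Subgroup H, Infinite G ∧ Countable G := by
  let f := Infinite.natEmbedding H
  refine ⟨Subgroup.closure (range f), ?_, ?_⟩
  · exact ((infinite_range_of_injective f.injective).mono Subgroup.subset_closure).to_subtype
  · rw [← mk_le_aleph0_iff]
    exact (mk_subgroup_closure_le _).trans (max_le (countable_range f).le_aleph0 le_rfl)

theorem Separating.not_bountifulDiscrete {P : TopGroupProperty.{u}} (hP : P.Separating) :
    ¬ P.BountifulDiscrete := by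
  intro hB
  obtain ⟨H, _, _, hL, hF⟩ := exists_lengthBounded_locallyFinite.{u}
  obtain ⟨G, hG, hGc⟩ := exists_countable_subgroup H
  obtain ⟨K, hK, hGK, hcard⟩ := hB H (@Separating.of_lengthBounded P hP H _ ⊥ hL) G hG
  have hKi : Infinite K := (infinite_coe_iff.1 hG |>.mono hGK).to_subtype
  have hKc : Countable K := by
    rw [← mk_le_aleph0_iff, ← hcard]
    exact mk_le_aleph0_iff.2 hGc
  exact @Separating.not_of_locallyFinite P hP K _ ⊥ (@DiscreteTopology.mk _ ⊥ rfl) hKi hKc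
    (hF.of_injective K.subtype K.subtype_injective) hK

/-- The discrete metric with distances `c`. -/
noncomputable abbrev uniformlyDiscreteMetric (H : Type*) (c : ℝ) (hc : 0 < c) : MetricSpace H := by
  classical exact
  { dist := fun x y => if x = y then 0 else c
    dist_self := fun x => by simp
    dist_comm := fun x y => by simp only [eq_comm]
    dist_triangle := fun x y z => by
      by_cases h1 : x = y <;> by_cases h2 : y = z <;> by_cases h3 : x = z <;>
        simp_all <;> linarith
    eq_of_dist_eq_zero := fun {x y} h => by
      by_contra hne
      simp only [if_neg hne] at h
      exact hc.ne' h }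

theorem Separating.not_bountifulMetric {P : TopGroupProperty.{u}} (hP : P.Separating)
    {D : ℝ≥0∞} (hD : 0 < D) : ¬ P.BountifulMetric D := by
  intro hB
  obtain ⟨H, _, _, hL, hF⟩ := exists_lengthBounded_locallyFinite.{u}
  obtain ⟨G, hG, hGc⟩ := exists_countable_subgroup H
  obtain ⟨c, hc0, hcD⟩ : ∃ c : ℝ, 0 < c ∧ ENNReal.ofReal c ≤ D := by
    -- The minimum with 1 keeps the constant finite when `D = ∞`.
    refine ⟨(min D 1).toReal, ENNReal.toReal_pos ?_ ?_, ?_⟩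
    · exact (lt_min hD one_pos).ne'
    · exact ((min_le_right D 1).trans_lt ENNReal.one_lt_top).ne
    · exact ENNReal.ofReal_toReal_le.trans (min_le_left _ _)
  let _ : MetricSpace H := uniformlyDiscreteMetric H c hc0
  have hdist : ∀ x y : H, x ≠ y → dist x y = c := fun x y h => if_neg h
  have hle : ∀ x y : H, dist x y ≤ c := fun x y => by
    by_cases h : x = y
    · rw [h, dist_self]; exact hc0.le
    · exact (hdist x y h).le
  have hpw : Pairwise fun x y : H => c ≤ dist x y := fun x y h => (hdist x y h).ge
  have hdisc : DiscreteTopology H := DiscreteTopology.of_forall_le_dist hc0 hpw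
  have hinv : ∀ f : H → H, Function.Injective f → ∀ x y, dist (f x) (f y) = dist x y := by
    intro f hf x y
    by_cases h : x = y
    · rw [h, dist_self, dist_self]
    · rw [hdist x y h, hdist _ _ (hf.ne h)]
  have hH : IsContinuousMetricGroup D H :=
    { complete := by
        refine Metric.complete_of_cauchySeq_tendsto fun u hu => ?_
        obtain ⟨N, hN⟩ := Metric.cauchySeq_iff'.1 hu c hc0
        refine ⟨u N, tendsto_const_nhds.congr' ?_⟩
        filter_upwards [Filter.eventually_ge_atTop N] with n hn
        by_contra hne
        exact absurd (hN n hn) (by rw [hdist _ _ (Ne.symm hne)]; exact lt_irrefl c)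
      dist_mul_left := fun a => hinv _ (mul_right_injective a)
      dist_mul_right := fun a => hinv _ (mul_left_injective a)
      edist_le := fun x y => by
        rw [edist_dist]
        exact (ENNReal.ofReal_le_ofReal (hle x y)).trans hcD }
  obtain ⟨K, -, hK, hGK, hcard⟩ := hB H inferInstance hH (hP.of_lengthBounded H hL) (G : Set H)
    (infinite_coe_iff.1 hG)
  rw [densityCharacter_of_discrete, densityCharacter_of_discrete] at hcard
  have hKi : Infinite K := (infinite_coe_iff.1 hG |>.mono hGK).to_subtype
  have hKc : Countable K := by
    rw [← mk_le_aleph0_iff, ← hcard]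
    exact mk_le_aleph0_iff.2 hGc
  exact hP.not_of_locallyFinite K hKi hKc (hF.of_injective K.subtype K.subtype_injective) hK

end TopGroupProperty

theorem separating_FH : PropertyFH.{u}.Separating where
  of_lengthBounded _ _ _ hG := hG.propertyOB.propertyFH
  not_of_locallyFinite K _ _ _ _ _ hK := by
    obtain ⟨N, hN⟩ := hK.exists_proper_ultrametricLength
    exact N.not_propertyFH hN

theorem separating_OB : PropertyOB.{u}.Separating where
  of_lengthBounded _ _ _ hG := hG.propertyOB
  not_of_locallyFinite K _ _ _ hi hc hK hOB :=
    separating_FH.not_of_locallyFinite K hi hc hK (PropertyOB.propertyFH hOB)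

theorem separating_FR : PropertyFR.{u}.Separating where
  of_lengthBounded _ _ _ hG := hG.propertyFR
  not_of_locallyFinite K _ _ _ _ _ hK := by
    obtain ⟨N, hN⟩ := hK.exists_proper_ultrametricLength
    refine N.not_propertyFR fun n => ?_
    obtain ⟨g, hg⟩ := (hN n).infinite_compl.nonempty
    exact ⟨g, not_le.1 hg⟩

theorem proposition1p5 :
    -- discrete groups, (a) and (b)
    ((¬ PropertyOB.{u}.BountifulDiscrete ∧
      ¬ PropertyFH.{u}.BountifulDiscrete ∧
      ¬ PropertyFR.{u}.BountifulDiscrete) ∧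
     (PropertyOB.{u}.Non.BountifulDiscrete ∧
      PropertyFH.{u}.Non.BountifulDiscrete ∧
      PropertyFR.{u}.Non.BountifulDiscrete)) ∧
    -- metric groups that are continuous structures, (a) and (b)
    (∀ D : ENNReal, 0 < D →
      (¬ PropertyOB.{u}.BountifulMetric D ∧
       ¬ PropertyFH.{u}.BountifulMetric D ∧
       ¬ PropertyFR.{u}.BountifulMetric D) ∧
      (PropertyOB.{u}.Non.BountifulMetric D ∧
       PropertyFH.{u}.Non.BountifulMetric D ∧
       PropertyFR.{u}.Non.BountifulMetric D)) := by
  refine ⟨⟨⟨?_, ?_, ?_⟩, ?_, ?_, ?_⟩, fun D hD => ⟨⟨?_, ?_, ?_⟩, ?_, ?_, ?_⟩⟩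
  · exact separating_OB.not_bountifulDiscrete
  · exact separating_FH.not_bountifulDiscrete
  · exact separating_FR.not_bountifulDiscrete
  · exact countablyWitnessed_OB.bountifulDiscrete
  · exact countablyWitnessed_FH.bountifulDiscrete
  · exact countablyWitnessed_FR.bountifulDiscrete
  · exact separating_OB.not_bountifulMetric hD
  · exact separating_FH.not_bountifulMetric hD
  · exact separating_FR.not_bountifulMetric hD
  · exact countablyWitnessed_OB.bountifulMetric D
  · exact countablyWitnessed_FH.bountifulMetric D
  · exact countablyWitnessed_FR.bountifulMetric D
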